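/- Let $H\subset\mathbf C$ be the upper half plane. Consider the following two families of groups $\Gamma$ of affine transformations of $\mathbf C^2$ preserving $H\times\mathbf C$. (1) Let $M\in SL(3,\mathbf Z)$ have eigenvalues $\alpha,\beta,\bar\beta$ with $\alpha>1$ and $\beta\ne\bar\beta$; let $(a_1,a_2,a_3)$ be a real eigenvector for $\alpha$ and $(b_1,b_2,b_3)$ an eigenvector for $\beta$. $\Gamma$ is generated by $\gamma_0(w,z)=(\alpha w,\beta z)$ and $\gamma_i(w,z)=(w+a_i,z+b_i)$, $i=1,2,3$. The quotient of $H\times\mathbf C$ by $\Gamma$ is the surface $S_M$. (2) Let $N=(n_{ij})\in SL(2,\mathbf Z)$ have real eigenvalues $\alpha>1$ and $\alpha^{-1}$, with real eigenvectors $(a_1,a_2)$ and $(b_1,b_2)$ respectively; let $p,q,r\in\mathbf Z$ with $r\neq0$, let $t\in\mathbf C$, and let $c_1,c_2\in\mathbf R$ satisfy $$(c_1,c_2)=(c_1,c_2)N^{t}+(e_1,e_2)+\tfrac1r(b_1a_2-b_2a_1)(p,q),$$ $$e_i=\tfrac12 n_{i1}(n_{i1}-1)a_1b_1+\tfrac12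 n_{i2}(n_{i2}-1)a_2b_2+n_{i1}n_{i2}b_1a_2,$$ where $N^t$ is the transpose of $N$. $\Gamma$ is generated by $\gamma_0(w,z)=(\alpha w,z+t)$, $\gamma_i(w,z)=(w+a_i,z+b_iw+c_i)$ for $i=1,2$, and $\gamma_3(w,z)=(w,z+r^{-1}(b_1a_2-b_2a_1))$. The quotient of $H\times\mathbf C$ by $\Gamma$ is the surface $S^+_{N,p,q,r,t}$. An Inoue surface is a complex surface $S$ which is biholomorphic to some $S_M$ or $S^+_{N,p,q,r,t}$, or which has an unramified double cover biholomorphic to such a surface. Let $\pi:H\times\mathbf C\to S$ be the resulting holomorphic covering (the quotient map, followed by the double covering $S'\to S$ in the second case). **Proposition.** Every Inoue surface $S$ admits exactly one torsion-free holomorphic affine connection $\nabla$. This connection is flat (locally isomorphic to the standard connection of $\mathbf C^2$), and it is induced from $\mathbf C^2$: its pullback by $\pi$ is the restriction to $H\times\mathbf C$ of the standard connection of $\mathbf C^2$. -/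

import Mathlib

open scoped Manifold ContDiff Matrix

universe u

namespace Inoue

/-- The open set `H × ℂ` of `ℂ²`, where `H` is the upper half plane. -/
def HC : Set (ℂ × ℂ) := {x | 0 < x.1.im}

/-- The data defining a surface `S_M`: a matrix `M ∈ SL(3, ℤ)` with eigenvalues `α`, `β` and
`conj β`, where `α > 1` and `β ≠ conj β`, a real eigenvector `a` for `α` and an eigenvector `b`
for `β`. (As `M` is real, `conj b` is then an eigenvector for `conj β`.) -/
structure SMData where
  M : Matrix.SpecialLinearGroup (Fin 3) ℤ
  α : ℝ
  β : ℂ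
  one_lt : 1 < α
  nonreal : β ≠ (starRingEnd ℂ) β
  a : Fin 3 → ℝ
  b : Fin 3 → ℂ
  a_ne : a ≠ 0
  b_ne : b ≠ 0
  eigen_a : M.1.map (Int.cast : ℤ → ℝ) *ᵥ a = α • a
  eigen_b : M.1.map (Int.cast : ℤ → ℂ) *ᵥ b = β • b

/-- The group generated by `γ₀ (w, z) = (α w, β z)` and `γᵢ (w, z) = (w + aᵢ, z + bᵢ)`,
`i = 1, 2, 3`. -/
def SMData.Γ (D : SMData) : Subgroup (Equiv.Perm (ℂ × ℂ)) :=
  Subgroup.closure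
    {g | (∀ w z : ℂ, g (w, z) = (D.α * w, D.β * z)) ∨
      ∃ i : Fin 3, ∀ w z : ℂ, g (w, z) = (w + D.a i, z + D.b i)}

/-- The data defining a surface `S⁺_{N,p,q,r,t}`: a matrix `N ∈ SL(2, ℤ)` with eigenvalues `α > 1`
and `α⁻¹` and real eigenvectors `a` and `b`, integers `p`, `q`, `r` with `r ≠ 0`, a complex number
`t`, and a real solution `c` of
`(c₁, c₂) = (c₁, c₂) Nᵗ + (e₁, e₂) + r⁻¹ (b₁ a₂ - b₂ a₁) (p, q)`, where
`eᵢ = nᵢ₁ (nᵢ₁ - 1) a₁ b₁ / 2 + nᵢ₂ (nᵢ₂ - 1) a₂ b₂ / 2 + nᵢ₁ nᵢ₂ b₁ a₂`.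
The indices `1, 2` are `0, 1` in `Fin 2`. -/
structure SPlusData where
  N : Matrix.SpecialLinearGroup (Fin 2) ℤ
  α : ℝ
  one_lt : 1 < α
  a : Fin 2 → ℝ
  b : Fin 2 → ℝ
  a_ne : a ≠ 0
  b_ne : b ≠ 0
  eigen_a : N.1.map (Int.cast : ℤ → ℝ) *ᵥ a = α • a
  eigen_b : N.1.map (Int.cast : ℤ → ℝ) *ᵥ b = α⁻¹ • b
  p : ℤ
  q : ℤ
  r : ℤ
  r_ne : r ≠ 0
  t : ℂ
  c : Fin 2 → ℝ
  c_eq : c = c ᵥ* (N.1.map (Int.cast : ℤ → ℝ))ᵀ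
      + (fun i ↦ (1 / 2 : ℝ) * (N.1 i 0 : ℝ) * ((N.1 i 0 : ℝ) - 1) * a 0 * b 0
          + (1 / 2 : ℝ) * (N.1 i 1 : ℝ) * ((N.1 i 1 : ℝ) - 1) * a 1 * b 1
          + (N.1 i 0 : ℝ) * (N.1 i 1 : ℝ) * b 0 * a 1)
      + ((r : ℝ)⁻¹ * (b 0 * a 1 - b 1 * a 0)) • ![(p : ℝ), (q : ℝ)]

/-- The group generated by `γ₀ (w, z) = (α w, z + t)`, `γᵢ (w, z) = (w + aᵢ, z + bᵢ w + cᵢ)` for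
`i = 1, 2`, and `γ₃ (w, z) = (w, z + r⁻¹ (b₁ a₂ - b₂ a₁))`. -/
def SPlusData.Γ (D : SPlusData) : Subgroup (Equiv.Perm (ℂ × ℂ)) :=
  Subgroup.closure
    {g | (∀ w z : ℂ, g (w, z) = (D.α * w, z + D.t)) ∨
      (∃ i : Fin 2, ∀ w z : ℂ, g (w, z) = (w + D.a i, z + D.b i * w + D.c i)) ∨
      ∀ w z : ℂ, g (w, z) =
        (w, z + (((D.r : ℝ)⁻¹ * (D.b 0 * D.a 1 - D.b 1 * D.a 0) : ℝ) : ℂ))}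

section Surfaces

variable {S : Type u} [TopologicalSpace S] [ChartedSpace (ℂ × ℂ) S]

/-- `π` exhibits the complex surface `S` as the quotient of `H × ℂ` by `Γ`: it is a local
biholomorphism of `H × ℂ` onto `S` whose fibres are the `Γ`-orbits. (The values of `π` outside
`H × ℂ` are irrelevant.) -/
structure IsQuotientBy (Γ : Subgroup (Equiv.Perm (ℂ × ℂ))) (π : ℂ × ℂ → S) : Prop where
  isLocalDiffeomorphOn : IsLocalDiffeomorphOn 𝓘(ℂ, ℂ × ℂ) 𝓘(ℂ, ℂ × ℂ) ω π HC
  surjOn : Set.SurjOn π HC Set.univ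
  fibre : ∀ x ∈ HC, ∀ y ∈ HC, π x = π y ↔ ∃ g ∈ Γ, g x = y

/-- `π : H × ℂ → S` exhibits `S` as a surface `S_M` or `S⁺_{N,p,q,r,t}`. -/
def IsInoueQuotient (π : ℂ × ℂ → S) : Prop :=
  (∃ D : SMData, IsQuotientBy D.Γ π) ∨ ∃ D : SPlusData, IsQuotientBy D.Γ π

/-- `π : H × ℂ → S` exhibits `S` as an Inoue surface: either `S` is a surface `S_M` or
`S⁺_{N,p,q,r,t}` with quotient map `π`, or `S` has an unramified double cover `q : S' → S` by such
a surface `S'`, with quotient map `π'`, and `π = q ∘ π'`. -/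
def IsInoueUniformization (π : ℂ × ℂ → S) : Prop :=
  IsInoueQuotient π ∨
    ∃ (S' : Type u) (_ : TopologicalSpace S') (_ : ChartedSpace (ℂ × ℂ) S')
      (_ : IsManifold 𝓘(ℂ, ℂ × ℂ) ω S') (π' : ℂ × ℂ → S') (q : S' → S),
      IsInoueQuotient π' ∧
      IsLocalDiffeomorph 𝓘(ℂ, ℂ × ℂ) 𝓘(ℂ, ℂ × ℂ) ω q ∧ IsCoveringMap q ∧
      (∀ y, (q ⁻¹' {y}).ncard = 2) ∧ ∀ x ∈ HC, π x = q (π' x)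

variable [IsManifold 𝓘(ℂ, ℂ × ℂ) ω S]

variable (S) in
/-- Affine connections on a complex surface `S`, i.e. covariant derivatives on the holomorphic
tangent bundle; `∇ Y x (X x)` is `∇_X Y` at `x`. Only the values on vector fields `Y` that are
complex differentiable at `x` are meaningful. -/
abbrev AffineConnection : Type u :=
  CovariantDerivative 𝓘(ℂ, ℂ × ℂ) (ℂ × ℂ) (TangentSpace 𝓘(ℂ, ℂ × ℂ) : S → Type)

/-- The connection is holomorphic: for every open `U`, it maps holomorphic vector fields on `U` to
holomorphic sections of `T*S ⊗ TS` on `U` (over `ℂ`, class `ω` means holomorphic). -/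
def IsHolomorphic (nabla : AffineConnection S) : Prop :=
  ∀ U : Set S, IsOpen U → ContMDiffCovariantDerivativeOn (ℂ × ℂ) ω nabla.toFun U

/-- The vector field `Y` on `S` is complex differentiable at `x`. -/
def DiffAt (Y : Π x : S, TangentSpace 𝓘(ℂ, ℂ × ℂ) x) (x : S) : Prop :=
  MDifferentiableAt 𝓘(ℂ, ℂ × ℂ) (𝓘(ℂ, ℂ × ℂ).prod 𝓘(ℂ, ℂ × ℂ))
    (fun y ↦ (Bundle.TotalSpace.mk' (ℂ × ℂ) y (Y y) : TangentBundle 𝓘(ℂ, ℂ × ℂ) S)) x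

/-- Two connections are the same: they agree on all vector fields they can be applied to. -/
def SameConnection (nabla nabla' : AffineConnection S) : Prop :=
  ∀ (Y : Π x : S, TangentSpace 𝓘(ℂ, ℂ × ℂ) x) (x : S),
    DiffAt Y x → nabla Y x = nabla' Y x

/-- On the open set `U ⊆ ℂ²`, on which `f` is a local biholomorphism, the pullback of the connection
by `f` is the standard connection of `ℂ²`: for every vector field `Y` on `S`, differentiating
`f^* Y` in the direction `v` gives the vector that `df` maps to `∇_{df(v)} Y`. -/
def PullsBackToStandard (f : ℂ × ℂ → S) (U : Set (ℂ × ℂ)) (nabla : AffineConnection S) : Prop :=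
  ∀ (Y : Π x : S, TangentSpace 𝓘(ℂ, ℂ × ℂ) x), ∀ x ∈ U, DiffAt Y (f x) →
    ∀ v : ℂ × ℂ,
      mfderiv 𝓘(ℂ, ℂ × ℂ) 𝓘(ℂ, ℂ × ℂ) f x
          (fderiv ℂ (fun y : ℂ × ℂ ↦
            (VectorField.mpullback 𝓘(ℂ, ℂ × ℂ) 𝓘(ℂ, ℂ × ℂ) f Y y : ℂ × ℂ)) x v) =
        nabla Y (f x) (mfderiv 𝓘(ℂ, ℂ × ℂ) 𝓘(ℂ, ℂ × ℂ) f x v)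

/-- The connection is flat: it is locally isomorphic to the standard connection of `ℂ²`. -/
def IsFlat (nabla : AffineConnection S) : Prop :=
  ∀ p : S, ∃ (f : ℂ × ℂ → S) (U : Set (ℂ × ℂ)), IsOpen U ∧ p ∈ f '' U ∧
    IsLocalDiffeomorphOn 𝓘(ℂ, ℂ × ℂ) 𝓘(ℂ, ℂ × ℂ) ω f U ∧ PullsBackToStandard f U nabla

end Surfaces

end Inoue

/-! Existence. `Γ` acts on `H × ℂ` by affine maps, so the standard connection of `ℂ²` is invariant
and descends to the quotient, where it is holomorphic, torsion-free and flat
(`pushDeriv_eq_of_affine`, `exists_connection`).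

Uniqueness. Two torsion-free holomorphic connections differ by a holomorphic section of `Sym² T* ⊗
T`. Its pullback to `H × ℂ` is `Γ`-equivariant, and such a tensor vanishes, for the following
reason. A holomorphic function invariant under the generators other than `γ₀` takes on each line
`{w} × ℂ` only values from a compact set, so by Liouville it depends on `w` alone. Conjugating a
translation `w ↦ w + a` by powers of `w ↦ α w` produces periods `α⁻ⁿ a → 0` whenever `γ₀` multiplies
the function by a nonzero factor, so the function is constant; if that factor is not `1`, it is
zero. For `S_M` every component of the tensor is of this kind (`tensor_eq_zero_of_lattice`). For
`S⁺` the shears mix the components triangularly. They are treated one after another, and a component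
that is only seen to be constant vanishes because it is the additive shift of another component
(`eq_zero_of_scaling`, `tensor_eq_zero_of_heisenberg`).

Double covers. The deck involution `σ` of `q : S' → S` carries the connection of `S'` to a
torsion-free holomorphic one, so by uniqueness on `S'` it preserves it, and the connection descends
to `S`. Uniqueness on `S` follows from the same tensor argument, which needs only that `π` be
`Γ`-invariant, not that its fibres be orbits. -/

open scoped Topology

namespace Inoue

/-! ### Transporting the standard connection along a local biholomorphism. -/

section Surfaces
variable {S : Type u} [TopologicalSpace S] [ChartedSpace (ℂ × ℂ) S]

/-- The derivative of a map from `ℂ²` to a surface, as an endomorphism of `ℂ²`. -/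
noncomputable def diffl (f : ℂ × ℂ → S) (x : ℂ × ℂ) : (ℂ × ℂ) →L[ℂ] (ℂ × ℂ) :=
  mfderiv 𝓘(ℂ, ℂ × ℂ) 𝓘(ℂ, ℂ × ℂ) f x

/-- The pullback to `ℂ²` of a vector field on a surface, as a function on `ℂ²`. -/
noncomputable def pullField (f : ℂ × ℂ → S) (Y : S → ℂ × ℂ) :
    ℂ × ℂ → ℂ × ℂ :=
  VectorField.mpullback 𝓘(ℂ, ℂ × ℂ) 𝓘(ℂ, ℂ × ℂ) f Y

/-- The covariant derivative of `Y` at `f x` for the connection which `f` makes correspond, near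
`x`, to the standard connection of `ℂ²`. -/
noncomputable def pushDeriv (f : ℂ × ℂ → S) (Y : S → ℂ × ℂ)
    (x : ℂ × ℂ) : (ℂ × ℂ) →L[ℂ] (ℂ × ℂ) :=
  diffl f x ∘L fderiv ℂ (pullField f Y) x ∘L (diffl f x).inverse

lemma diffl_isInvertible {f : ℂ × ℂ → S} {x : ℂ × ℂ}
    (hf : IsLocalDiffeomorphAt 𝓘(ℂ, ℂ × ℂ) 𝓘(ℂ, ℂ × ℂ) ω f x) : (diffl f x).IsInvertible :=
  ⟨hf.mfderivToContinuousLinearEquiv (by simp), rfl⟩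

lemma pullField_apply (f : ℂ × ℂ → S) (Y : S → ℂ × ℂ) (x : ℂ × ℂ) :
    pullField f Y x = (diffl f x).inverse (Y (f x)) := rfl

lemma diffl_pullField {f : ℂ × ℂ → S} {x : ℂ × ℂ}
    (hf : IsLocalDiffeomorphAt 𝓘(ℂ, ℂ × ℂ) 𝓘(ℂ, ℂ × ℂ) ω f x)
    (Y : S → ℂ × ℂ) : diffl f x (pullField f Y x) = Y (f x) := by
  rw [pullField_apply]
  exact (diffl_isInvertible hf).self_apply_inverse _

lemma contMDiffAt_pullField [IsManifold 𝓘(ℂ, ℂ × ℂ) ω S] {f : ℂ × ℂ → S} {x : ℂ × ℂ}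
    (hf : IsLocalDiffeomorphAt 𝓘(ℂ, ℂ × ℂ) 𝓘(ℂ, ℂ × ℂ) ω f x)
    {Y : S → ℂ × ℂ}
    (hY : ContMDiffAt 𝓘(ℂ, ℂ × ℂ) (𝓘(ℂ, ℂ × ℂ).prod 𝓘(ℂ, ℂ × ℂ)) ω
      (fun y ↦ (Bundle.TotalSpace.mk' (ℂ × ℂ) y (Y y) : TangentBundle 𝓘(ℂ, ℂ × ℂ) S)) (f x)) :
    ContDiffAt ℂ ω (pullField f Y) x := by
  have : IsManifold 𝓘(ℂ, ℂ × ℂ) 1 S := .of_le (n := ω) le_top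
  refine contMDiffAt_vectorSpace_iff_contDiffAt.1 ?_
  exact ContMDiffAt.mpullback_vectorField_preimage hY hf.contMDiffAt (diffl_isInvertible hf) le_top

lemma differentiableAt_pullField [IsManifold 𝓘(ℂ, ℂ × ℂ) ω S] {f : ℂ × ℂ → S} {x : ℂ × ℂ}
    (hf : IsLocalDiffeomorphAt 𝓘(ℂ, ℂ × ℂ) 𝓘(ℂ, ℂ × ℂ) ω f x)
    {Y : S → ℂ × ℂ} (hY : DiffAt Y (f x)) :
    DifferentiableAt ℂ (pullField f Y) x := by
  have : IsManifold 𝓘(ℂ, ℂ × ℂ) 2 S := .of_le (n := ω) le_top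
  have h := MDifferentiableAt.mpullback_vectorField hY hf.contMDiffAt (diffl_isInvertible hf) le_top
  rw [mdifferentiableAt_section] at h
  simpa using! h.differentiableAt

lemma pushDeriv_apply_diffl {f : ℂ × ℂ → S} {x : ℂ × ℂ}
    (hf : IsLocalDiffeomorphAt 𝓘(ℂ, ℂ × ℂ) 𝓘(ℂ, ℂ × ℂ) ω f x)
    (Y : S → ℂ × ℂ) (v : ℂ × ℂ) :
    pushDeriv f Y x (diffl f x v) = diffl f x (fderiv ℂ (pullField f Y) x v) := by
  simp [pushDeriv, (diffl_isInvertible hf).inverse_apply_self]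

lemma pushDeriv_apply {f : ℂ × ℂ → S} {x : ℂ × ℂ}
    (hf : IsLocalDiffeomorphAt 𝓘(ℂ, ℂ × ℂ) 𝓘(ℂ, ℂ × ℂ) ω f x) (Y Z : S → ℂ × ℂ) :
    pushDeriv f Y x (Z (f x)) =
      diffl f x (fderiv ℂ (pullField f Y) x (pullField f Z x)) := by
  rw [← pushDeriv_apply_diffl hf, diffl_pullField hf]

lemma pushDeriv_add [IsManifold 𝓘(ℂ, ℂ × ℂ) ω S] {f : ℂ × ℂ → S} {x : ℂ × ℂ}
    (hf : IsLocalDiffeomorphAt 𝓘(ℂ, ℂ × ℂ) 𝓘(ℂ, ℂ × ℂ) ω f x)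
    {Y Z : S → ℂ × ℂ} (hY : DiffAt Y (f x)) (hZ : DiffAt Z (f x)) :
    pushDeriv f (Y + Z) x = pushDeriv f Y x + pushDeriv f Z x := by
  have h : pullField f (Y + Z) = pullField f Y + pullField f Z := VectorField.mpullback_add
  have hd : fderiv ℂ (pullField f Y + pullField f Z) x = _ :=
    fderiv_add (differentiableAt_pullField hf hY) (differentiableAt_pullField hf hZ)
  rw [pushDeriv, h, hd]
  ext <;> simp [pushDeriv]

lemma mfderiv_smooth_comp {f : ℂ × ℂ → S} {x : ℂ × ℂ}
    (hf : IsLocalDiffeomorphAt 𝓘(ℂ, ℂ × ℂ) 𝓘(ℂ, ℂ × ℂ) ω f x) {g : S → ℂ}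
    (hg : MDifferentiableAt 𝓘(ℂ, ℂ × ℂ) 𝓘(ℂ, ℂ) g (f x)) (v : ℂ × ℂ) :
    fderiv ℂ (g ∘ f) x v = mvfderiv 𝓘(ℂ, ℂ × ℂ) g (f x) (diffl f x v) := by
  rw [← mfderiv_eq_fderiv, mfderiv_comp x hg (hf.mdifferentiableAt (by simp))]
  rfl

lemma pushDeriv_smul [IsManifold 𝓘(ℂ, ℂ × ℂ) ω S] {f : ℂ × ℂ → S} {x : ℂ × ℂ}
    (hf : IsLocalDiffeomorphAt 𝓘(ℂ, ℂ × ℂ) 𝓘(ℂ, ℂ × ℂ) ω f x)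
    {Y : S → ℂ × ℂ} (hY : DiffAt Y (f x)) {g : S → ℂ}
    (hg : MDifferentiableAt 𝓘(ℂ, ℂ × ℂ) 𝓘(ℂ, ℂ) g (f x)) (v : ℂ × ℂ) :
    pushDeriv f (g • Y) x v =
      g (f x) • pushDeriv f Y x v + mvfderiv 𝓘(ℂ, ℂ × ℂ) g (f x) v • Y (f x) := by
  have h : pullField f (g • Y) = fun y ↦ (g ∘ f) y • pullField f Y y :=
    funext fun y ↦ VectorField.mpullback_smul_apply
  have hgf : DifferentiableAt ℂ (g ∘ f) x :=
    (hg.comp x (hf.mdifferentiableAt (by simp))).differentiableAt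
  obtain ⟨v, rfl⟩ : ∃ w, v = diffl f x w :=
    ⟨(diffl f x).inverse v, ((diffl_isInvertible hf).self_apply_inverse v).symm⟩
  rw [← mfderiv_smooth_comp hf hg, pushDeriv_apply_diffl hf, pushDeriv_apply_diffl hf, h,
    fderiv_fun_smul hgf (differentiableAt_pullField hf hY)]
  simp only [_root_.add_apply, _root_.smul_apply,
    ContinuousLinearMap.smulRight_apply, map_add, map_smul, diffl_pullField hf]
  rfl

lemma mlieBracket_eq_fderiv (V W : Π x : ℂ × ℂ, TangentSpace 𝓘(ℂ, ℂ × ℂ) x) (x : ℂ × ℂ) :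
    VectorField.mlieBracket 𝓘(ℂ, ℂ × ℂ) V W x =
      fderiv ℂ (W : ℂ × ℂ → ℂ × ℂ) x (V x) - fderiv ℂ (V : ℂ × ℂ → ℂ × ℂ) x (W x) := by
  have h : VectorField.lieBracketWithin ℂ (V : ℂ × ℂ → ℂ × ℂ) W Set.univ x = _ :=
    congrFun VectorField.lieBracketWithin_univ x
  rw [← VectorField.mlieBracketWithin_univ, VectorField.mlieBracketWithin_eq_lieBracketWithin]
  exact h

/-- This is the vanishing of the torsion of the induced connection: pullback commutes with Lie
brackets, and on `ℂ²` the bracket is the antisymmetrized derivative. -/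
lemma pushDeriv_sub_pushDeriv [IsManifold 𝓘(ℂ, ℂ × ℂ) ω S] {f : ℂ × ℂ → S} {x : ℂ × ℂ}
    (hf : IsLocalDiffeomorphAt 𝓘(ℂ, ℂ × ℂ) 𝓘(ℂ, ℂ × ℂ) ω f x)
    {Y Z : S → ℂ × ℂ} (hY : DiffAt Y (f x)) (hZ : DiffAt Z (f x)) :
    pushDeriv f Z x (Y (f x)) - pushDeriv f Y x (Z (f x)) =
      VectorField.mlieBracket 𝓘(ℂ, ℂ × ℂ) Y Z (f x) := by
  have : IsManifold 𝓘(ℂ, ℂ × ℂ) (minSmoothness ℂ 2) S := .of_le (n := ω) le_top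
  have h := VectorField.mpullback_mlieBracket hY hZ hf.contMDiffAt le_top
  rw [mlieBracket_eq_fderiv] at h
  rw [pushDeriv_apply hf, pushDeriv_apply hf, ← map_sub]
  exact (congrArg (diffl f x) h.symm).trans (diffl_pullField hf _)

/-- Holomorphy of an endomorphism field can be tested on the sections that are constant in a local
trivialization: their images are the columns of its matrix. -/
lemma contMDiffAt_hom_of_apply [IsManifold 𝓘(ℂ, ℂ × ℂ) ω S] {p : S}
    {φ : Π y : S, TangentSpace 𝓘(ℂ, ℂ × ℂ) y →L[ℂ] TangentSpace 𝓘(ℂ, ℂ × ℂ) y}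
    (h : ∀ Z : Π x : S, TangentSpace 𝓘(ℂ, ℂ × ℂ) x,
      ContMDiffAt 𝓘(ℂ, ℂ × ℂ) (𝓘(ℂ, ℂ × ℂ).prod 𝓘(ℂ, ℂ × ℂ)) ω
        (fun y ↦ (Bundle.TotalSpace.mk' (ℂ × ℂ) y (Z y) : TangentBundle 𝓘(ℂ, ℂ × ℂ) S)) p →
      ContMDiffAt 𝓘(ℂ, ℂ × ℂ) (𝓘(ℂ, ℂ × ℂ).prod 𝓘(ℂ, ℂ × ℂ)) ω
        (fun y ↦ (Bundle.TotalSpace.mk' (ℂ × ℂ) y (φ y (Z y)) : TangentBundle 𝓘(ℂ, ℂ × ℂ) S)) p) :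
    ContMDiffAt 𝓘(ℂ, ℂ × ℂ) (𝓘(ℂ, ℂ × ℂ).prod 𝓘(ℂ, (ℂ × ℂ) →L[ℂ] (ℂ × ℂ))) ω
      (fun y ↦ (Bundle.TotalSpace.mk' ((ℂ × ℂ) →L[ℂ] (ℂ × ℂ))
        (E := fun y : S ↦ TangentSpace 𝓘(ℂ, ℂ × ℂ) y →L[ℂ] TangentSpace 𝓘(ℂ, ℂ × ℂ) y)
        y (φ y))) p := by
  rw [contMDiffAt_hom_bundle]
  refine ⟨contMDiffAt_id, ?_⟩
  set T := fun y ↦ ContinuousLinearMap.inCoordinates (ℂ × ℂ)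
    (TangentSpace 𝓘(ℂ, ℂ × ℂ) : S → Type) (ℂ × ℂ) (TangentSpace 𝓘(ℂ, ℂ × ℂ) : S → Type)
    p y p y (φ y) with hT
  have key : ∀ v : ℂ × ℂ, ContMDiffAt 𝓘(ℂ, ℂ × ℂ) 𝓘(ℂ, ℂ × ℂ) ω (fun y ↦ T y v) p := by
    intro v
    set t := trivializationAt (ℂ × ℂ) (TangentSpace 𝓘(ℂ, ℂ × ℂ) : S → Type) p
    have hp : p ∈ t.baseSet := FiberBundle.mem_baseSet_trivializationAt' p
    have hZ : ContMDiffAt 𝓘(ℂ, ℂ × ℂ) (𝓘(ℂ, ℂ × ℂ).prod 𝓘(ℂ, ℂ × ℂ)) ω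
        (fun y ↦ (Bundle.TotalSpace.mk' (ℂ × ℂ) y (t.symmL ℂ y v) :
          TangentBundle 𝓘(ℂ, ℂ × ℂ) S)) p := by
      rw [t.contMDiffAt_section_iff hp]
      refine (contMDiffAt_const (c := v)).congr_of_eventuallyEq ?_
      filter_upwards [t.open_baseSet.mem_nhds hp] with y hy
      simp [t.symmL_apply hy, t.apply_mk_symm hy]
    have hφ := h _ hZ
    rw [t.contMDiffAt_section_iff hp] at hφ
    refine hφ.congr_of_eventuallyEq ?_
    filter_upwards [t.open_baseSet.mem_nhds hp] with y hy
    simp [T, ContinuousLinearMap.inCoordinates, t.coe_linearMapAt_of_mem hy, t]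
  -- An endomorphism of `ℂ²` is rebuilt, by a fixed linear formula, from the images of the two basis
  -- vectors.
  have e : T = fun y ↦ (ContinuousLinearMap.smulRightL ℂ (ℂ × ℂ) (ℂ × ℂ)
        (ContinuousLinearMap.fst ℂ ℂ ℂ)) (T y (1, 0)) +
      (ContinuousLinearMap.smulRightL ℂ (ℂ × ℂ) (ℂ × ℂ)
        (ContinuousLinearMap.snd ℂ ℂ ℂ)) (T y (0, 1)) := by
    funext y
    refine ContinuousLinearMap.ext fun v ↦ ?_
    have hv : v = v.1 • (1, 0) + v.2 • (0, 1) := by simp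
    conv_lhs => rw [hv]
    rw [map_add, map_smul, map_smul]
    rfl
  change ContMDiffAt _ _ ω T p
  rw [e]
  exact ((ContinuousLinearMap.contMDiff _).contMDiffAt.comp p (key _)).add
    ((ContinuousLinearMap.contMDiff _).contMDiffAt.comp p (key _))

/-- Local biholomorphisms are open, so local properties on `S` may be checked upstairs. -/
lemma eventually_nhds_of_eventually_comp {f : ℂ × ℂ → S} {x : ℂ × ℂ}
    (hf : IsLocalDiffeomorphAt 𝓘(ℂ, ℂ × ℂ) 𝓘(ℂ, ℂ × ℂ) ω f x) {P : S → Prop}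
    (h : ∀ᶠ y in 𝓝 x, P (f y)) : ∀ᶠ p in 𝓝 (f x), P p := by
  have hx : hf.localInverse (f x) = x := hf.localInverse_left_inv hf.localInverse_mem_target
  have hcont := hf.localInverse_contMDiffAt.continuousAt
  rw [ContinuousAt, hx] at hcont
  filter_upwards [hcont.eventually h, hf.localInverse_eventuallyEq_right] with p hp hp'
  rw [← show f (hf.localInverse p) = p from hp']
  exact hp

lemma eventually_isLocalDiffeomorphAt {f : ℂ × ℂ → S} {x : ℂ × ℂ}
    (hf : IsLocalDiffeomorphAt 𝓘(ℂ, ℂ × ℂ) 𝓘(ℂ, ℂ × ℂ) ω f x) :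
    ∀ᶠ y in 𝓝 x, IsLocalDiffeomorphAt 𝓘(ℂ, ℂ × ℂ) 𝓘(ℂ, ℂ × ℂ) ω f y := by
  obtain ⟨Φ, hx, hΦ⟩ := hf
  filter_upwards [Φ.open_source.mem_nhds hx] with y hy using ⟨Φ, hy, hΦ⟩

/-- A holomorphic vector field on `ℂ²` can locally be pushed forward by a local biholomorphism. -/
lemma exists_pushField [IsManifold 𝓘(ℂ, ℂ × ℂ) ω S] {f : ℂ × ℂ → S} {x : ℂ × ℂ}
    (hf : IsLocalDiffeomorphAt 𝓘(ℂ, ℂ × ℂ) 𝓘(ℂ, ℂ × ℂ) ω f x) {W : ℂ × ℂ → ℂ × ℂ}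
    (hW : ContDiffAt ℂ ω W x) :
    ∃ Z : S → ℂ × ℂ, ContMDiffAt 𝓘(ℂ, ℂ × ℂ) (𝓘(ℂ, ℂ × ℂ).prod 𝓘(ℂ, ℂ × ℂ)) ω
        (fun y ↦ (Bundle.TotalSpace.mk' (ℂ × ℂ) y (Z y) : TangentBundle 𝓘(ℂ, ℂ × ℂ) S)) (f x) ∧
      ∀ᶠ y in 𝓝 x, Z (f y) = diffl f y (W y) := by
  have : IsManifold 𝓘(ℂ, ℂ × ℂ) 1 S := .of_le (n := ω) le_top
  have hx : hf.localInverse (f x) = x := hf.localInverse_left_inv hf.localInverse_mem_target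
  refine ⟨VectorField.mpullback 𝓘(ℂ, ℂ × ℂ) 𝓘(ℂ, ℂ × ℂ) hf.localInverse W, ?_, ?_⟩
  · refine ContMDiffAt.mpullback_vectorField_preimage (n := ω) ?_ hf.localInverse_contMDiffAt
      ⟨hf.localInverse_isLocalDiffeomorphAt.mfderivToContinuousLinearEquiv (by simp), rfl⟩ le_top
    rw [hx]
    exact contMDiffAt_vectorSpace_iff_contDiffAt.2 hW
  · filter_upwards [eventually_isLocalDiffeomorphAt hf,
      hf.localInverse.open_target.mem_nhds hf.localInverse_mem_target,
      hf.contMDiffAt.continuousAt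
        (hf.localInverse.open_source.mem_nhds hf.localInverse_mem_source)] with y hy hy' hs
    have hΦ := hf.localInverse.isLocalDiffeomorphAt _ _ _ hs
    have hcomp := mfderiv_comp y (hΦ.mdifferentiableAt (by simp)) (hy.mdifferentiableAt (by simp))
    have hid : (hf.localInverse ∘ f) =ᶠ[𝓝 y] id := Filter.eventuallyEq_of_mem
      (hf.localInverse.open_target.mem_nhds hy') hf.localInverse_eqOn_left
    rw [hid.mfderiv_eq, mfderiv_id] at hcomp
    have hA : (mfderiv 𝓘(ℂ, ℂ × ℂ) 𝓘(ℂ, ℂ × ℂ) hf.localInverse (f y) :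
        (ℂ × ℂ) →L[ℂ] (ℂ × ℂ)).IsInvertible := ⟨hΦ.mfderivToContinuousLinearEquiv (by simp), rfl⟩
    have hW' : (mfderiv 𝓘(ℂ, ℂ × ℂ) 𝓘(ℂ, ℂ × ℂ) hf.localInverse (f y) :
        (ℂ × ℂ) →L[ℂ] (ℂ × ℂ)) (diffl f y (W y)) = W y :=
      (congrArg (fun T : (ℂ × ℂ) →L[ℂ] (ℂ × ℂ) ↦ T (W y)) hcomp).symm
    have hv := hA.inverse_apply_self (diffl f y (W y))
    rw [hW'] at hv
    refine Eq.trans ?_ hv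
    exact congrArg (fun z ↦ (mfderiv 𝓘(ℂ, ℂ × ℂ) 𝓘(ℂ, ℂ × ℂ) hf.localInverse (f y) :
        (ℂ × ℂ) →L[ℂ] (ℂ × ℂ)).inverse (W z)) (hf.localInverse_left_inv hy')

lemma isOpen_HC : IsOpen HC :=
  isOpen_lt continuous_const (Complex.continuous_im.comp continuous_fst)

/-- If `f : HC → S` is a surjective local biholomorphism all of whose transition maps preserve the
standard connection, then the latter descends to `S`. -/
theorem exists_connection [IsManifold 𝓘(ℂ, ℂ × ℂ) ω S] {f : ℂ × ℂ → S}
    (hf : IsLocalDiffeomorphOn 𝓘(ℂ, ℂ × ℂ) 𝓘(ℂ, ℂ × ℂ) ω f HC) (hs : Set.SurjOn f HC Set.univ)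
    (hc : ∀ x ∈ HC, ∀ y ∈ HC, f x = f y → ∀ Y : S → ℂ × ℂ, DiffAt Y (f x) →
      pushDeriv f Y x = pushDeriv f Y y) :
    ∃ nabla : AffineConnection S, IsHolomorphic nabla ∧ nabla.torsion = 0 ∧
      PullsBackToStandard f HC nabla ∧ IsFlat nabla := by
  -- An arbitrary section, with no continuity: by `hc` the choice of preimage does not affect
  -- derivatives of differentiable fields.
  choose g hg hfg using fun p ↦ hs (Set.mem_univ p)
  have hf' (x) (hx : x ∈ HC) : IsLocalDiffeomorphAt 𝓘(ℂ, ℂ × ℂ) 𝓘(ℂ, ℂ × ℂ) ω f x := hf ⟨x, hx⟩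
  let cov : (Π x : S, TangentSpace 𝓘(ℂ, ℂ × ℂ) x) →
      (Π x : S, TangentSpace 𝓘(ℂ, ℂ × ℂ) x →L[ℂ] TangentSpace 𝓘(ℂ, ℂ × ℂ) x) :=
    fun Y p ↦ pushDeriv f Y (g p)
  have hcov : ∀ x ∈ HC, ∀ Y : S → ℂ × ℂ, DiffAt Y (f x) → cov Y (f x) = pushDeriv f Y x :=
    fun x hx Y hY ↦ hc _ (hg _) _ hx (hfg _) Y (by rwa [hfg])
  have isCov : IsCovariantDerivativeOn (ℂ × ℂ) cov Set.univ := by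
    constructor
    · intro Y Z p hY hZ _
      obtain ⟨x, hx, rfl⟩ := hs (Set.mem_univ p)
      rw [hcov x hx _ hY, hcov x hx _ hZ, hcov x hx _ (mdifferentiableAt_add_section hY hZ)]
      exact pushDeriv_add (hf' x hx) hY hZ
    · intro Y u p hY hu _
      obtain ⟨x, hx, rfl⟩ := hs (Set.mem_univ p)
      rw [hcov x hx _ hY, hcov x hx _ (hu.smul_section hY)]
      exact ContinuousLinearMap.ext fun v ↦ pushDeriv_smul (hf' x hx) hY hu v
  let nabla : AffineConnection S := ⟨cov, isCov⟩
  have hpull : PullsBackToStandard f HC nabla := fun Y x hx hY v ↦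
    ((congrArg (fun T : (ℂ × ℂ) →L[ℂ] (ℂ × ℂ) ↦ T (diffl f x v)) (hcov x hx Y hY)).trans
      (pushDeriv_apply_diffl (hf' x hx) Y v)).symm
  have hflat : IsFlat nabla := fun p ↦ by
    obtain ⟨x, hx, rfl⟩ := hs (Set.mem_univ p)
    exact ⟨f, HC, isOpen_HC, ⟨x, hx, rfl⟩, hf, hpull⟩
  refine ⟨nabla, ?_, ?_, hpull, hflat⟩
  · intro U hU
    refine ⟨fun {Y} hY p hp ↦ (contMDiffAt_hom_of_apply fun Z hZ ↦ ?_).contMDiffWithinAt⟩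
    obtain ⟨x, hx, rfl⟩ := hs (Set.mem_univ p)
    have hY' := (hY (f x) hp).contMDiffAt (hU.mem_nhds hp)
    -- Upstairs, `∇_Z Y` is the directional derivative of the pulled-back fields, which is visibly
    -- holomorphic.
    have hW : ContDiffAt ℂ ω (fun y ↦ fderiv ℂ (pullField f Y) y (pullField f Z y)) x :=
      ((contMDiffAt_pullField (hf' x hx) hY').fderiv_right le_rfl).clm_apply
        (contMDiffAt_pullField (hf' x hx) hZ)
    obtain ⟨V, hV, hfV⟩ := exists_pushField (hf' x hx) hW
    refine hV.congr_of_eventuallyEq (eventually_nhds_of_eventually_comp (hf' x hx) ?_)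
    have hfU : ∀ᶠ y in 𝓝 x, f y ∈ U := (hf' x hx).contMDiffAt.continuousAt (hU.mem_nhds hp)
    filter_upwards [hfV, isOpen_HC.mem_nhds hx, hfU] with y hy hyH hyU
    have hYy : DiffAt Y (f y) := ((hY (f y) hyU).contMDiffAt (hU.mem_nhds hyU)).mdifferentiableAt
      (by simp)
    refine congrArg (Bundle.TotalSpace.mk' (ℂ × ℂ) (f y)) (Eq.trans ?_ hy.symm)
    exact (congrArg (fun T : (ℂ × ℂ) →L[ℂ] (ℂ × ℂ) ↦ T (Z (f y))) (hcov y hyH Y hYy)).trans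
      (pushDeriv_apply (hf' y hyH) Y Z)
  · rw [CovariantDerivative.torsion_eq_zero_iff]
    intro X Y p hX hY
    obtain ⟨x, hx, rfl⟩ := hs (Set.mem_univ p)
    have h := pushDeriv_sub_pushDeriv (hf' x hx) hX hY
    rw [← hcov x hx _ hX, ← hcov x hx _ hY] at h
    exact h

end Surfaces

/-! ### Behaviour of the induced connection under affine changes and under composition. -/

section Transitions
variable {S : Type u} [TopologicalSpace S] [ChartedSpace (ℂ × ℂ) S]

lemma diffl_eq_comp {f : ℂ × ℂ → S} {g : ℂ × ℂ → ℂ × ℂ} {L : (ℂ × ℂ) →L[ℂ] (ℂ × ℂ)} {x : ℂ × ℂ}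
    (hf : IsLocalDiffeomorphAt 𝓘(ℂ, ℂ × ℂ) 𝓘(ℂ, ℂ × ℂ) ω f (g x)) (hg : HasFDerivAt g L x)
    (hfg : f ∘ g =ᶠ[𝓝 x] f) : diffl f x = diffl f (g x) ∘L L := by
  have h := mfderiv_comp x (hf.mdifferentiableAt (by simp)) hg.hasMFDerivAt.mdifferentiableAt
  rw [hfg.mfderiv_eq, hg.hasMFDerivAt.mfderiv] at h
  exact h

lemma inverse_comp_of_isInvertible {A B : (ℂ × ℂ) →L[ℂ] (ℂ × ℂ)} (hA : A.IsInvertible)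
    (hB : B.IsInvertible) : (A ∘L B).inverse = B.inverse ∘L A.inverse := by
  obtain ⟨a, rfl⟩ := hA
  obtain ⟨b, rfl⟩ := hB
  simp
  rfl

/-- The connection induced by `f` is not changed by an affine transformation `g` with
`f ∘ g = f`. -/
lemma pushDeriv_eq_of_affine [IsManifold 𝓘(ℂ, ℂ × ℂ) ω S] {f : ℂ × ℂ → S} {x c : ℂ × ℂ}
    {g : ℂ × ℂ → ℂ × ℂ} {L : (ℂ × ℂ) ≃L[ℂ] (ℂ × ℂ)} (hg : ∀ y, g y = L y + c)
    (hf : ∀ᶠ y in 𝓝 x, IsLocalDiffeomorphAt 𝓘(ℂ, ℂ × ℂ) 𝓘(ℂ, ℂ × ℂ) ω f (g y))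
    (hfg : f ∘ g =ᶠ[𝓝 x] f) {Y : S → ℂ × ℂ} (hY : DiffAt Y (f x)) :
    pushDeriv f Y x = pushDeriv f Y (g x) := by
  have hgd : ∀ y, HasFDerivAt g (L : (ℂ × ℂ) →L[ℂ] (ℂ × ℂ)) y := fun y ↦ by
    rw [funext hg]
    exact L.hasFDerivAt.add_const c
  have hd : ∀ᶠ y in 𝓝 x, (diffl f y).inverse =
      (L.symm : (ℂ × ℂ) →L[ℂ] (ℂ × ℂ)) ∘L (diffl f (g y)).inverse := by
    filter_upwards [hf, hfg.eventuallyEq_nhds] with y hy hfy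
    rw [diffl_eq_comp hy (hgd y) hfy, inverse_comp_of_isInvertible (diffl_isInvertible hy) ⟨L, rfl⟩,
      ContinuousLinearMap.inverse_equiv]
  have hp : pullField f Y =ᶠ[𝓝 x]
      (L.symm : (ℂ × ℂ) →L[ℂ] (ℂ × ℂ)) ∘ pullField f Y ∘ g := by
    filter_upwards [hd, hfg] with y hy hfy
    simp only [Function.comp_apply, pullField_apply] at hfy ⊢
    rw [hy, hfy]
    rfl
  have hx : f (g x) = f x := hfg.self_of_nhds
  have hYg : DifferentiableAt ℂ (pullField f Y) (g x) :=
    differentiableAt_pullField hf.self_of_nhds (by rwa [hx])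
  -- The linear part `L` of `g` is constant, so no second derivative of `g` appears; this is where
  -- affinity enters.
  have hfd : fderiv ℂ (pullField f Y) x = (L.symm : (ℂ × ℂ) →L[ℂ] (ℂ × ℂ)) ∘L
      fderiv ℂ (pullField f Y) (g x) ∘L (L : (ℂ × ℂ) →L[ℂ] (ℂ × ℂ)) := by
    rw [hp.fderiv_eq]
    exact (L.symm.hasFDerivAt.comp x (hYg.hasFDerivAt.comp x (hgd x))).fderiv
  rw [pushDeriv, pushDeriv, hd.self_of_nhds, hfd, diffl_eq_comp hf.self_of_nhds (hgd x) hfg]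
  ext <;> simp

variable {S' : Type u} [TopologicalSpace S'] [ChartedSpace (ℂ × ℂ) S']

/-- The derivative of a map between surfaces, as an endomorphism of `ℂ²`. -/
noncomputable def diffl' (q : S' → S) (p : S') : (ℂ × ℂ) →L[ℂ] (ℂ × ℂ) :=
  mfderiv 𝓘(ℂ, ℂ × ℂ) 𝓘(ℂ, ℂ × ℂ) q p

/-- The pullback of a vector field by a map between surfaces. -/
noncomputable def pullField' (q : S' → S) (Y : S → ℂ × ℂ) : S' → ℂ × ℂ :=
  VectorField.mpullback 𝓘(ℂ, ℂ × ℂ) 𝓘(ℂ, ℂ × ℂ) q Y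

lemma pullField'_apply (q : S' → S) (Y : S → ℂ × ℂ) (p : S') :
    pullField' q Y p = (diffl' q p).inverse (Y (q p)) := rfl

/-- The connection induced by a composition `q ∘ f`. -/
lemma pushDeriv_comp {f : ℂ × ℂ → S'} {h : ℂ × ℂ → S} {q : S' → S} {x : ℂ × ℂ}
    (hf : IsLocalDiffeomorphAt 𝓘(ℂ, ℂ × ℂ) 𝓘(ℂ, ℂ × ℂ) ω f x)
    (hq : IsLocalDiffeomorph 𝓘(ℂ, ℂ × ℂ) 𝓘(ℂ, ℂ × ℂ) ω q) (hh : h =ᶠ[𝓝 x] q ∘ f) (Y : S → ℂ × ℂ) :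
    pushDeriv h Y x = diffl' q (f x) ∘L
      pushDeriv f (pullField' q Y) x ∘L
        (diffl' q (f x)).inverse := by
  have hqi : ∀ p, (diffl' q p).IsInvertible := fun p ↦
    ⟨(hq p).mfderivToContinuousLinearEquiv (by simp), rfl⟩
  have hd : ∀ᶠ y in 𝓝 x, diffl h y = diffl' q (f y) ∘L diffl f y := by
    filter_upwards [eventually_isLocalDiffeomorphAt hf, hh.eventuallyEq_nhds] with y hy hhy
    have e := mfderiv_comp y ((hq (f y)).mdifferentiableAt (by simp))
      (hy.mdifferentiableAt (by simp))
    rw [← hhy.mfderiv_eq] at e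
    exact e
  have hi : ∀ᶠ y in 𝓝 x, (diffl h y).inverse = (diffl f y).inverse ∘L (diffl' q (f y)).inverse := by
    filter_upwards [hd, eventually_isLocalDiffeomorphAt hf] with y hy hfy
    rw [hy, inverse_comp_of_isInvertible (hqi _) (diffl_isInvertible hfy)]
  have hp : pullField h Y =ᶠ[𝓝 x]
      pullField f (pullField' q Y) := by
    filter_upwards [hi, hh] with y hy hhy
    rw [pullField_apply, pullField_apply, pullField'_apply, hy, hhy]
    rfl
  rw [pushDeriv, pushDeriv, hp.fderiv_eq, hi.self_of_nhds, hd.self_of_nhds]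
  rfl

/-- If both `f₁` and `f₂` pull back a connection on `S'` to the standard one, then the connections
which they induce on `S` by means of `q : S' → S` agree. -/
lemma pushDeriv_comp_eq_of_pullsBack [IsManifold 𝓘(ℂ, ℂ × ℂ) ω S] [IsManifold 𝓘(ℂ, ℂ × ℂ) ω S']
    {f₁ f₂ : ℂ × ℂ → S'} {h : ℂ × ℂ → S} {q : S' → S}
    (hf₁ : IsLocalDiffeomorphOn 𝓘(ℂ, ℂ × ℂ) 𝓘(ℂ, ℂ × ℂ) ω f₁ HC)
    (hf₂ : IsLocalDiffeomorphOn 𝓘(ℂ, ℂ × ℂ) 𝓘(ℂ, ℂ × ℂ) ω f₂ HC)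
    (hq : IsLocalDiffeomorph 𝓘(ℂ, ℂ × ℂ) 𝓘(ℂ, ℂ × ℂ) ω q)
    (hh₁ : ∀ x ∈ HC, h x = q (f₁ x)) (hh₂ : ∀ x ∈ HC, h x = q (f₂ x))
    {nabla : AffineConnection S'} (h₁ : PullsBackToStandard f₁ HC nabla)
    (h₂ : PullsBackToStandard f₂ HC nabla) {x y : ℂ × ℂ} (hx : x ∈ HC) (hy : y ∈ HC)
    (hxy : f₁ x = f₂ y) {Y : S → ℂ × ℂ} (hY : DiffAt Y (h x)) :
    pushDeriv h Y x = pushDeriv h Y y := by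
  have : IsManifold 𝓘(ℂ, ℂ × ℂ) 2 S := .of_le (n := ω) le_top
  have : IsManifold 𝓘(ℂ, ℂ × ℂ) 2 S' := .of_le (n := ω) le_top
  set Y' : S' → ℂ × ℂ := pullField' q Y with hY'
  have hYd : DiffAt Y' (f₁ x) := by
    rw [hh₁ x hx] at hY
    exact MDifferentiableAt.mpullback_vectorField hY (hq _).contMDiffAt
      ⟨(hq (f₁ x)).mfderivToContinuousLinearEquiv (by simp), rfl⟩ le_top
  -- A connection that pulls back to the standard one is recovered as `pushDeriv`, whichever map is
  -- used.
  have key : ∀ (f : ℂ × ℂ → S') (z : ℂ × ℂ), z ∈ HC →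
      IsLocalDiffeomorphOn 𝓘(ℂ, ℂ × ℂ) 𝓘(ℂ, ℂ × ℂ) ω f HC → PullsBackToStandard f HC nabla →
      DiffAt Y' (f z) → pushDeriv f Y' z = nabla Y' (f z) := by
    intro f z hz hf hn hd
    have hf : IsLocalDiffeomorphAt 𝓘(ℂ, ℂ × ℂ) 𝓘(ℂ, ℂ × ℂ) ω f z := hf ⟨z, hz⟩
    refine ContinuousLinearMap.ext fun v ↦ ?_
    obtain ⟨v, rfl⟩ : ∃ w, diffl f z w = v :=
      ⟨(diffl f z).inverse v, (diffl_isInvertible hf).self_apply_inverse v⟩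
    rw [pushDeriv_apply_diffl hf]
    exact hn Y' z hz hd v
  have ev₁ : h =ᶠ[𝓝 x] q ∘ f₁ := Filter.eventuallyEq_of_mem (isOpen_HC.mem_nhds hx) hh₁
  have ev₂ : h =ᶠ[𝓝 y] q ∘ f₂ := Filter.eventuallyEq_of_mem (isOpen_HC.mem_nhds hy) hh₂
  rw [pushDeriv_comp (hf₁ ⟨x, hx⟩) hq ev₁, pushDeriv_comp (hf₂ ⟨y, hy⟩) hq ev₂, ← hY', key f₁ x hx hf₁ h₁ hYd,
    key f₂ y hy hf₂ h₂ (by rwa [← hxy]), hxy]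

end Transitions

/-! ### Liouville-type rigidity of quasi-invariant functions on `H × ℂ`. -/

section Analysis

/-- A function which takes all its values on a line `{w} × ℂ` already on a compact set is constant
on this line. -/
lemma apply_eq_apply_of_forall_exists_mem {φ : ℂ × ℂ → ℂ} {w : ℂ}
    (hd : Differentiable ℂ fun z ↦ φ (w, z)) {K : Set (ℂ × ℂ)} (hK : IsCompact K)
    (hφ : ContinuousOn φ K) (h : ∀ z, ∃ k ∈ K, φ (w, z) = φ k) (z z' : ℂ) :
    φ (w, z) = φ (w, z') := by
  refine hd.apply_eq_apply_of_bounded ((hK.image_of_continuousOn hφ).isBounded.subset ?_) z z'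
  rintro _ ⟨z, rfl⟩
  obtain ⟨k, hk, e⟩ := h z
  exact ⟨k, hk, e.symm⟩

/-- A holomorphic function on the upper half plane with arbitrarily small periods is constant. -/
lemma eq_of_small_periods {k : ℂ → ℂ} (hk : ∀ w : ℂ, 0 < w.im → DifferentiableAt ℂ k w)
    {ε : ℕ → ℂ} (hε : Filter.Tendsto ε Filter.atTop (𝓝 0)) (hε0 : ∀ n, ε n ≠ 0)
    (hp : ∀ n, ∀ w : ℂ, 0 < w.im → k (w + ε n) = k w) {w w' : ℂ} (hw : 0 < w.im)
    (hw' : 0 < w'.im) : k w = k w' := by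
  have hopen : IsOpen {w : ℂ | 0 < w.im} := isOpen_lt continuous_const Complex.continuous_im
  refine hopen.is_const_of_deriv_eq_zero (convex_halfSpace_im_gt 0).isPreconnected
    (fun w hw ↦ (hk w hw).differentiableWithinAt) (fun w hw ↦ ?_) hw hw'
  -- Along the periods `ε n → 0` all difference quotients are zero, hence so is the derivative.
  have h1 := (hasDerivAt_iff_tendsto_slope_zero.1 (hk w hw).hasDerivAt).comp
    (tendsto_nhdsWithin_iff.2 ⟨hε, Filter.Eventually.of_forall hε0⟩)
  refine tendsto_nhds_unique h1 (tendsto_const_nhds.congr fun n ↦ ?_)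
  simp [hp n w hw]

section Scaling
variable {k : ℂ → ℂ} {α a : ℝ} {l D : ℂ}

lemma apply_pow_mul (hα : 1 < α) (h0 : ∀ w : ℂ, 0 < w.im → k (α * w) = l * k w) (n : ℕ) {w : ℂ}
    (hw : 0 < w.im) : k (α ^ n * w) = l ^ n * k w := by
  induction n with
  | zero => simp
  | succ n ih =>
    have : 0 < ((α : ℂ) ^ n * w).im := by
      rw [← Complex.ofReal_pow, Complex.im_ofReal_mul]
      positivity
    rw [pow_succ', mul_assoc, h0 _ this, ih]
    ring

/-- Conjugating the translation by `a` with the `n`-th power of the scaling gives the translation by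
`α⁻ⁿ a`; the factor `lⁿ` divides the increment. -/
lemma apply_add_inv_pow_mul (hα : 1 < α) (hl : l ≠ 0)
    (h0 : ∀ w : ℂ, 0 < w.im → k (α * w) = l * k w)
    (h1 : ∀ w : ℂ, 0 < w.im → k (w + a) = k w - D) (n : ℕ) {w : ℂ} (hw : 0 < w.im) :
    k (w + (α⁻¹ ^ n * a : ℝ)) = k w - (l ^ n)⁻¹ * D := by
  have hα1 : (α : ℂ) ≠ 0 := by exact_mod_cast (by positivity : α ≠ 0)
  have hw1 : 0 < (w + (α⁻¹ ^ n * a : ℝ)).im := by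
    rwa [Complex.add_im, Complex.ofReal_im, add_zero]
  have hw2 : 0 < ((α : ℂ) ^ n * w).im := by
    rw [← Complex.ofReal_pow, Complex.im_ofReal_mul]
    positivity
  have e : (α : ℂ) ^ n * (w + (α⁻¹ ^ n * a : ℝ)) = α ^ n * w + a := by
    rw [mul_add]
    push_cast
    rw [← mul_assoc ((α : ℂ) ^ n) ((α : ℂ)⁻¹ ^ n), ← mul_pow, mul_inv_cancel₀ hα1, one_pow, one_mul]
  have h := apply_pow_mul hα h0 n hw1
  rw [e, h1 _ hw2, apply_pow_mul hα h0 n hw] at h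
  have hl' : l ^ n ≠ 0 := pow_ne_zero _ hl
  apply mul_left_cancel₀ hl'
  rw [mul_sub, ← mul_assoc, mul_inv_cancel₀ hl', one_mul]
  exact h.symm

lemma tendsto_inv_pow_mul (hα : 1 < α) (a : ℝ) :
    Filter.Tendsto (fun n : ℕ ↦ ((α⁻¹ ^ n * a : ℝ) : ℂ)) Filter.atTop (𝓝 0) := by
  have := (tendsto_pow_atTop_nhds_zero_of_lt_one (by positivity) (inv_lt_one_of_one_lt₀ hα)).mul_const a
  rw [zero_mul] at this
  exact_mod_cast (Complex.continuous_ofReal.tendsto 0).comp this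

/-- The increments of `k` under the translations by `α⁻ⁿ a → 0` are `-l⁻ⁿ D`. They tend to `0` by
continuity, yet have norm at least `‖D‖` because `‖l‖ ≤ 1`. -/
lemma eq_zero_of_scaling (hk : ∀ w : ℂ, 0 < w.im → DifferentiableAt ℂ k w) (hα : 1 < α)
    (hl : l ≠ 0) (hl1 : ‖l‖ ≤ 1) (h0 : ∀ w : ℂ, 0 < w.im → k (α * w) = l * k w)
    (h1 : ∀ w : ℂ, 0 < w.im → k (w + a) = k w - D) : D = 0 := by
  have hI : 0 < Complex.I.im := by simp
  have h2 : Filter.Tendsto (fun n : ℕ ↦ Complex.I + ((α⁻¹ ^ n * a : ℝ) : ℂ)) Filter.atTop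
      (𝓝 Complex.I) := by
    simpa using (tendsto_inv_pow_mul hα a).const_add Complex.I
  have h3 := ((hk _ hI).continuousAt.tendsto.comp h2).const_sub (k Complex.I)
  rw [sub_self] at h3
  have h4 : ∀ n : ℕ, k Complex.I - (k ∘ fun n : ℕ ↦ Complex.I + ((α⁻¹ ^ n * a : ℝ) : ℂ)) n =
      (l ^ n)⁻¹ * D := fun n ↦ by
    rw [Function.comp_apply, apply_add_inv_pow_mul hα hl h0 h1 n hI]
    ring
  have h5 := (Filter.tendsto_congr h4).1 h3
  have h6 := h5.norm
  rw [norm_zero] at h6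
  have h7 : ‖D‖ ≤ 0 := ge_of_tendsto h6 (Filter.Eventually.of_forall fun n ↦ by
    rw [norm_mul, norm_inv, norm_pow]
    exact le_mul_of_one_le_left (norm_nonneg _)
      ((one_le_inv₀ (pow_pos (norm_pos_iff.2 hl) n)).2 (pow_le_one₀ (norm_nonneg _) hl1)))
  exact norm_le_zero_iff.1 h7

/-- With `D = 0` the numbers `α⁻ⁿ a` are arbitrarily small periods. -/
lemma eq_of_scaling (hk : ∀ w : ℂ, 0 < w.im → DifferentiableAt ℂ k w) (hα : 1 < α)
    (hl : l ≠ 0) (ha : a ≠ 0) (h0 : ∀ w : ℂ, 0 < w.im → k (α * w) = l * k w)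
    (h1 : ∀ w : ℂ, 0 < w.im → k (w + a) = k w) {w w' : ℂ} (hw : 0 < w.im) (hw' : 0 < w'.im) :
    k w = k w' := by
  refine eq_of_small_periods hk (tendsto_inv_pow_mul hα a) (fun n ↦ ?_) (fun n w hw ↦ ?_) hw hw'
  · have : α⁻¹ ^ n * a ≠ 0 := by positivity
    exact_mod_cast this
  · rw [apply_add_inv_pow_mul (D := 0) hα hl h0 (by simpa using h1) n hw]
    simp

end Scaling

/-- A function on `HC` which is invariant under translations by the vectors `(aᵢ, bᵢ)` spanning
`ℝ × ℂ` is constant on the lines `{w} × ℂ`. -/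
lemma apply_eq_of_lattice {h : ℂ × ℂ → ℂ} (hd : DifferentiableOn ℂ h HC) {a : Fin 3 → ℝ}
    {b : Fin 3 → ℂ}
    (hspan : ∀ z : ℂ, ∃ r : Fin 3 → ℝ, ∑ i, r i * a i = 0 ∧ ∑ i, (r i : ℂ) * b i = z)
    (hi : ∀ i, ∀ w z : ℂ, 0 < w.im → h (w + a i, z + b i) = h (w, z)) {w : ℂ} (hw : 0 < w.im)
    (z z' : ℂ) : h (w, z) = h (w, z') := by
  let T : AddSubgroup (ℝ × ℂ) :=
    { carrier := {v | ∀ w z : ℂ, 0 < w.im → h (w + v.1, z + v.2) = h (w, z)}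
      zero_mem' := fun w z _ ↦ by simp
      add_mem' := fun {u v} hu hv w z hw ↦ by
        have := hv (w + u.1) (z + u.2) (by simpa using hw)
        rw [hu w z hw] at this
        rw [← this]
        simp [add_assoc]
      neg_mem' := fun {v} hv w z hw ↦ by
        have := hv (w + (-v).1) (z + (-v).2) (by simpa using hw)
        rw [← this]
        simp }
  have hT : ∀ n : Fin 3 → ℤ, (∑ i, n i * a i, ∑ i, n i * b i) ∈ T := fun n ↦ by
    have h1 : ∑ i, n i • ((a i, b i) : ℝ × ℂ) ∈ T :=
      T.sum_mem fun i _ ↦ T.zsmul_mem (fun w z hw ↦ hi i w z hw) _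
    convert h1 using 1
    refine Prod.ext ?_ ?_
    · rw [Prod.fst_sum]
      change ∑ i, (n i : ℝ) * a i = ∑ i, n i • a i
      simp only [zsmul_eq_mul]
    · rw [Prod.snd_sum]
      change ∑ i, (n i : ℂ) * b i = ∑ i, n i • b i
      simp only [zsmul_eq_mul]
  -- The image of the unit cube is a compact fundamental region for the slice; it stays in `HC`
  -- since the `a i` are real.
  let F : (Fin 3 → ℝ) → ℂ × ℂ := fun f ↦ (w + ∑ i, (f i * a i : ℝ), ∑ i, (f i : ℂ) * b i)
  have hF : Continuous F := by fun_prop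
  have hFH : F '' Set.Icc 0 1 ⊆ HC := by
    rintro _ ⟨f, -, rfl⟩
    simpa [F, HC, ← Complex.ofReal_mul, ← Complex.ofReal_sum] using hw
  refine apply_eq_apply_of_forall_exists_mem (fun z ↦ ?_) (isCompact_Icc.image hF)
    (hd.continuousOn.mono hFH) (fun z ↦ ?_) z z'
  · exact ((hd.differentiableAt (isOpen_HC.mem_nhds (x := (w, z)) hw)).comp z
      (by fun_prop : DifferentiableAt ℂ (fun z ↦ (w, z)) z))
  · obtain ⟨r, h1, h2⟩ := hspan z
    -- Subtracting the integer parts of `r` is a lattice translation. Since `∑ r i * a i = 0`, what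
    -- remains of the first coordinate comes from the fractional parts alone.
    refine ⟨_, ⟨fun i ↦ Int.fract (r i), ⟨fun i ↦ Int.fract_nonneg _,
      fun i ↦ (Int.fract_lt_one _).le⟩, rfl⟩, ?_⟩
    have hn := hT (fun i ↦ -⌊r i⌋) w z hw
    rw [← hn, ← h2]
    have e1 : ∑ i, ((-⌊r i⌋ : ℤ) : ℝ) * a i = ∑ i, Int.fract (r i) * a i := by
      rw [← sub_eq_zero, ← Finset.sum_sub_distrib, ← neg_eq_zero, ← h1, ← Finset.sum_neg_distrib]
      refine Finset.sum_congr rfl fun i _ ↦ ?_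
      rw [Int.fract]
      push_cast
      ring
    have e2 : ∑ i, (r i : ℂ) * b i + ∑ i, ((-⌊r i⌋ : ℤ) : ℂ) * b i =
        ∑ i, ((Int.fract (r i) : ℝ) : ℂ) * b i := by
      rw [← Finset.sum_add_distrib]
      refine Finset.sum_congr rfl fun i _ ↦ ?_
      rw [Int.fract]
      push_cast
      ring
    simp only [F, e1, e2]

/-- A function on `HC` which is invariant under translations by the vectors `(aᵢ, bᵢ)` spanning
`ℝ × ℂ` and homogeneous under `(w, z) ↦ (α w, β z)` is constant. -/
lemma eq_of_lattice_of_scaling {h : ℂ × ℂ → ℂ} (hd : DifferentiableOn ℂ h HC) {a : Fin 3 → ℝ}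
    {b : Fin 3 → ℂ} {α : ℝ} {β l : ℂ} (hα : 1 < α) (hl : l ≠ 0) (ha : a ≠ 0)
    (hspan : ∀ z : ℂ, ∃ r : Fin 3 → ℝ, ∑ i, r i * a i = 0 ∧ ∑ i, (r i : ℂ) * b i = z)
    (hi : ∀ i, ∀ w z : ℂ, 0 < w.im → h (w + a i, z + b i) = h (w, z))
    (h0 : ∀ w z : ℂ, 0 < w.im → h (α * w, β * z) = l * h (w, z)) {x y : ℂ × ℂ} (hx : x ∈ HC)
    (hy : y ∈ HC) : h x = h y := by
  have hz := fun (w : ℂ) (hw : 0 < w.im) ↦ apply_eq_of_lattice hd hspan hi hw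
  obtain ⟨i, hai⟩ := Function.ne_iff.1 ha
  have hαw : ∀ w : ℂ, 0 < w.im → 0 < (α * w).im := fun w hw ↦ by
    rw [Complex.im_ofReal_mul]
    positivity
  rw [show x = (x.1, x.2) from rfl, show y = (y.1, y.2) from rfl, hz _ hx x.2 0, hz _ hy y.2 0]
  refine eq_of_scaling (k := fun w ↦ h (w, 0)) (fun w hw ↦ ?_) hα hl hai (fun w hw ↦ ?_)
    (fun w hw ↦ ?_) hx hy
  · exact ((hd.differentiableAt (isOpen_HC.mem_nhds (x := (w, 0)) hw)).comp w
      (by fun_prop : DifferentiableAt ℂ (fun w : ℂ ↦ (w, (0 : ℂ))) w))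
  · rw [← h0 w 0 hw]
    exact hz _ (hαw w hw) _ _
  · rw [← hi i w 0 hw]
    exact hz _ (by simpa using hw) _ _

/-! ### Functions quasi-invariant under a Heisenberg lattice. -/

section Heisenberg
variable {φ : ℂ × ℂ → ℂ}

/-- Only `Im z` is tracked, and it grows linearly in `n` because real translations fix `Im w`; the
real part is handled later by the period `s`. -/
lemma exists_iterate {a b c : ℝ}
    (h : ∀ w z : ℂ, 0 < w.im → φ (w + a, z + (b * w + c)) = φ (w, z)) (n : ℤ) {w : ℂ}
    (hw : 0 < w.im) (z : ℂ) :
    ∃ z' : ℂ, z'.im = z.im + n * b * w.im ∧ φ (w + (n * a : ℝ), z') = φ (w, z) := by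
  induction n using Int.induction_on with
  | zero => exact ⟨z, by simp⟩
  | succ n ih =>
    obtain ⟨z', h1, h2⟩ := ih
    refine ⟨z' + (b * (w + ((n : ℤ) * a : ℝ)) + c), ?_, ?_⟩
    · simp [h1]
      ring
    · rw [← h2, ← h _ z' (by simpa using hw)]
      congr 2
      push_cast
      ring
  | pred n ih =>
    obtain ⟨z', h1, h2⟩ := ih
    refine ⟨z' - (b * (w + ((-(n : ℤ) - 1 : ℤ) * a : ℝ)) + c), ?_, ?_⟩
    · simp [h1]
      ring
    · rw [← h2, ← h _ _ (by simpa using hw)]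
      congr 2
      · push_cast
        ring
      · ring

/-- Invariant functions under a Heisenberg lattice take all their values on a line `{w} × ℂ`
already on a compact subset of `HC`. -/
lemma exists_compact_of_heisenberg {a b c : Fin 2 → ℝ} {s : ℝ} (hs : s ≠ 0)
    (hab : b 0 * a 1 - b 1 * a 0 ≠ 0)
    (h : ∀ i, ∀ w z : ℂ, 0 < w.im → φ (w + a i, z + (b i * w + c i)) = φ (w, z))
    (h3 : ∀ w z : ℂ, 0 < w.im → φ (w, z + s) = φ (w, z)) {w : ℂ} (hw : 0 < w.im) :
    ∃ K ⊆ HC, IsCompact K ∧ ∀ z, ∃ k ∈ K, φ (w, z) = φ k := by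
  -- Coordinates: one for `Re z` modulo `s` and two for the fractional parts of the exponents; the
  -- last one does not enter.
  let F : ℝ × (ℝ × ℝ × ℝ) → ℂ × ℂ := fun f ↦
    (w - (f.2.1 * a 0 + f.2.2.1 * a 1 : ℝ),
      (f.1 * s : ℝ) - (f.2.1 * b 0 + f.2.2.1 * b 1 : ℝ) * w.im * Complex.I)
  have hF : Continuous F := by fun_prop
  refine ⟨F '' Set.Icc 0 1, ?_, isCompact_Icc.image hF, fun z ↦ ?_⟩
  · rintro _ ⟨f, -, rfl⟩
    change 0 < (w - (f.2.1 * a 0 + f.2.2.1 * a 1 : ℝ)).im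
    rw [Complex.sub_im, Complex.ofReal_im]
    simpa using hw
  -- Real exponents which would keep `w` fixed and bring `Im z` to `0`; applying their integer parts
  -- misses this only by a bounded amount.
  · obtain ⟨r, r', hr, hr'⟩ : ∃ r r' : ℝ, r * a 0 + r' * a 1 = 0 ∧
        r * b 0 + r' * b 1 = -z.im / w.im := by
      refine ⟨a 1 * (-z.im / w.im) / (b 0 * a 1 - b 1 * a 0),
        -a 0 * (-z.im / w.im) / (b 0 * a 1 - b 1 * a 0), ?_, ?_⟩
      · ring
      · rw [div_mul_eq_mul_div, div_mul_eq_mul_div, ← add_div, div_eq_iff hab]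
        ring
    obtain ⟨z₁, hz₁, e₁⟩ := exists_iterate (h 0) ⌊r⌋ hw z
    have hw₁ : 0 < (w + (⌊r⌋ * a 0 : ℝ)).im := by
      rw [Complex.add_im, Complex.ofReal_im]
      simpa using hw
    obtain ⟨z₂, hz₂, e₂⟩ := exists_iterate (h 1) ⌊r'⌋ hw₁ z₁
    have hw₂ : 0 < (w + (⌊r⌋ * a 0 : ℝ) + (⌊r'⌋ * a 1 : ℝ)).im := by
      rw [Complex.add_im, Complex.ofReal_im]
      simpa using hw₁
    have hper : Function.Periodic (fun z ↦ φ (w + (⌊r⌋ * a 0 : ℝ) + (⌊r'⌋ * a 1 : ℝ), z)) (s : ℂ) :=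
      fun z ↦ h3 _ z hw₂
    have e₃ := hper.sub_int_mul_eq (x := z₂) ⌊z₂.re / s⌋
    refine ⟨_, ⟨(Int.fract (z₂.re / s), Int.fract r, Int.fract r', 0),
      ⟨⟨Int.fract_nonneg _, Int.fract_nonneg _, Int.fract_nonneg _, le_rfl⟩,
        (Int.fract_lt_one _).le, (Int.fract_lt_one _).le, (Int.fract_lt_one _).le, zero_le_one⟩,
        rfl⟩, ?_⟩
    rw [← e₁, ← e₂, ← e₃]
    congr 2
    · have : (⌊r⌋ * a 0 : ℝ) + ⌊r'⌋ * a 1 = -(Int.fract r * a 0 + Int.fract r' * a 1) := by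
        rw [Int.fract, Int.fract]
        linear_combination hr
      rw [add_assoc, ← Complex.ofReal_add, this]
      push_cast
      ring
    · have him : z₂.im = -((Int.fract r * b 0 + Int.fract r' * b 1) * w.im) := by
        rw [hz₂, hz₁, Int.fract, Int.fract, Complex.add_im, Complex.ofReal_im]
        field_simp at hr'
        linear_combination hr'
      apply Complex.ext
      · have hre : Int.fract (z₂.re / s) * s = z₂.re - ⌊z₂.re / s⌋ * s := by
          rw [Int.fract, sub_mul, div_mul_cancel₀ _ hs]
        simp [hre]
      · simp [him]

/-- Differentiation in `z` removes the additive terms `b i * C`, so Liouville applies to `∂h/∂z`.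
Hence `h` is affine in `z`, and its period `s ≠ 0` forces the slope to be zero. -/
lemma apply_eq_of_heisenberg {h : ℂ × ℂ → ℂ} (hd : ContDiffOn ℂ ω h HC)
    {a b c : Fin 2 → ℝ} {s : ℝ} {C : ℂ} (hs : s ≠ 0) (hab : b 0 * a 1 - b 1 * a 0 ≠ 0)
    (hi : ∀ i, ∀ w z : ℂ, 0 < w.im → h (w + a i, z + (b i * w + c i)) = h (w, z) - b i * C)
    (h3 : ∀ w z : ℂ, 0 < w.im → h (w, z + s) = h (w, z)) {w : ℂ} (hw : 0 < w.im) (z : ℂ) :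
    h (w, z) = h (w, 0) := by
  have hdz : ∀ w : ℂ, 0 < w.im → ∀ z, HasDerivAt (fun z ↦ h (w, z)) (fderiv ℂ h (w, z) (0, 1)) z :=
    fun w hw z ↦ by
      have h1 := ((hd.differentiableOn (by simp)).differentiableAt
        (isOpen_HC.mem_nhds (x := (w, z)) hw)).hasFDerivAt
      exact h1.comp_hasDerivAt z ((hasDerivAt_const z w).prodMk (hasDerivAt_id z))
  let φ : ℂ × ℂ → ℂ := fun x ↦ deriv (fun z ↦ h (x.1, z)) x.2
  have hφ : ContinuousOn φ HC := by
    have h1 : ContinuousOn (fun x ↦ fderiv ℂ h x (0, 1)) HC :=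
      (hd.continuousOn_fderiv_of_isOpen isOpen_HC (by simp)).clm_apply continuousOn_const
    exact h1.congr fun x hx ↦ (hdz x.1 hx x.2).deriv
  have hdw : Differentiable ℂ fun z ↦ h (w, z) := fun z ↦ (hdz w hw z).differentiableAt
  have hdφ : Differentiable ℂ fun z ↦ φ (w, z) := by
    have := (hdw.contDiff (n := 2)).differentiable_deriv_two
    exact this
  have hφi : ∀ i, ∀ w z : ℂ, 0 < w.im → φ (w + a i, z + (b i * w + c i)) = φ (w, z) := by
    intro i w z hw
    simp only [φ]
    rw [← deriv_comp_add_const, funext fun z ↦ hi i w z hw, deriv_sub_const]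
  have hφ3 : ∀ w z : ℂ, 0 < w.im → φ (w, z + s) = φ (w, z) := by
    intro w z hw
    simp only [φ]
    rw [← deriv_comp_add_const, funext fun z ↦ h3 w z hw]
  obtain ⟨K, hKH, hK, hKφ⟩ := exists_compact_of_heisenberg hs hab hφi hφ3 hw
  have hconst := fun z ↦ apply_eq_apply_of_forall_exists_mem hdφ hK (hφ.mono hKH) hKφ z 0
  have hlin : ∀ z, h (w, z) - φ (w, 0) * z = h (w, 0) := fun z ↦ by
    have hdg : Differentiable ℂ fun z ↦ h (w, z) - φ (w, 0) * z :=
      hdw.sub (differentiable_id.const_mul _)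
    have := is_const_of_deriv_eq_zero hdg (fun z ↦ by
      rw [deriv_fun_sub (hdw z) (by fun_prop), show deriv (fun z ↦ h (w, z)) z = φ (w, z) from rfl,
        hconst z, deriv_const_mul_field]
      simp) z 0
    simpa using this
  have hm : φ (w, 0) = 0 := by
    have h1 := hlin s
    have h2 := h3 w 0 hw
    rw [zero_add] at h2
    rw [h2] at h1
    have : φ (w, 0) * s = 0 := by linear_combination -h1
    simpa [hs] using this
  simpa [hm] using hlin z

variable {h : ℂ × ℂ → ℂ} {a b c : Fin 2 → ℝ} {s α : ℝ} {C l t : ℂ}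

/-- As `h` depends on `w` only, this is `eq_zero_of_scaling` with `D = b i * C` for some `b i ≠ 0`.
-/
lemma eq_zero_of_heisenberg (hd : ContDiffOn ℂ ω h HC) (hs : s ≠ 0)
    (hab : b 0 * a 1 - b 1 * a 0 ≠ 0)
    (hi : ∀ i, ∀ w z : ℂ, 0 < w.im → h (w + a i, z + (b i * w + c i)) = h (w, z) - b i * C)
    (h3 : ∀ w z : ℂ, 0 < w.im → h (w, z + s) = h (w, z)) (hα : 1 < α) (hl : l ≠ 0) (hl1 : ‖l‖ ≤ 1)
    (h0 : ∀ w z : ℂ, 0 < w.im → h (α * w, z + t) = l * h (w, z)) : C = 0 := by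
  have hz := fun (w : ℂ) (hw : 0 < w.im) ↦ apply_eq_of_heisenberg hd hs hab hi h3 hw
  have hαw : ∀ w : ℂ, 0 < w.im → 0 < (α * w).im := fun w hw ↦ by
    rw [Complex.im_ofReal_mul]
    positivity
  obtain ⟨i, hbi⟩ : ∃ i, b i ≠ 0 := by
    by_contra! hb
    simp [hb] at hab
  have := eq_zero_of_scaling (k := fun w ↦ h (w, 0)) (a := a i) (D := b i * C) (fun w hw ↦ ?_)
    hα hl hl1 (fun w hw ↦ ?_) (fun w hw ↦ ?_)
  · simpa [hbi] using this
  · exact (((hd.differentiableOn (by simp)).differentiableAt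
      (isOpen_HC.mem_nhds (x := (w, 0)) hw)).comp w
      (by fun_prop : DifferentiableAt ℂ (fun w : ℂ ↦ (w, (0 : ℂ))) w))
  · rw [← h0 w 0 hw]
    exact (hz _ (hαw w hw) _).symm
  · rw [← hi i w 0 hw]
    exact (hz _ (by simpa using hw) _).symm

lemma eq_of_heisenberg (hd : ContDiffOn ℂ ω h HC) (hs : s ≠ 0)
    (hab : b 0 * a 1 - b 1 * a 0 ≠ 0)
    (hi : ∀ i, ∀ w z : ℂ, 0 < w.im → h (w + a i, z + (b i * w + c i)) = h (w, z))
    (h3 : ∀ w z : ℂ, 0 < w.im → h (w, z + s) = h (w, z)) (hα : 1 < α) (hl : l ≠ 0)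
    (h0 : ∀ w z : ℂ, 0 < w.im → h (α * w, z + t) = l * h (w, z)) {x y : ℂ × ℂ} (hx : x ∈ HC)
    (hy : y ∈ HC) : h x = h y := by
  have hz := fun (w : ℂ) (hw : 0 < w.im) ↦
    apply_eq_of_heisenberg (C := 0) hd hs hab (by simpa using hi) h3 hw
  have hαw : ∀ w : ℂ, 0 < w.im → 0 < (α * w).im := fun w hw ↦ by
    rw [Complex.im_ofReal_mul]
    positivity
  obtain ⟨i, hai⟩ : ∃ i, a i ≠ 0 := by
    by_contra! ha
    simp [ha] at hab
  rw [show x = (x.1, x.2) from rfl, show y = (y.1, y.2) from rfl, hz _ hx x.2, hz _ hy y.2]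
  refine eq_of_scaling (k := fun w ↦ h (w, 0)) (fun w hw ↦ ?_) hα hl hai (fun w hw ↦ ?_)
    (fun w hw ↦ ?_) hx hy
  · exact (((hd.differentiableOn (by simp)).differentiableAt
      (isOpen_HC.mem_nhds (x := (w, 0)) hw)).comp w
      (by fun_prop : DifferentiableAt ℂ (fun w : ℂ ↦ (w, (0 : ℂ))) w))
  · rw [← h0 w 0 hw]
    exact (hz _ (hαw w hw) _).symm
  · rw [← hi i w 0 hw]
    exact (hz _ (by simpa using hw) _).symm

end Heisenberg
end Analysis

/-! ### The difference of two connections as an equivariant tensor on `H × ℂ`. -/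

section Difference
variable {S : Type u} [TopologicalSpace S] [ChartedSpace (ℂ × ℂ) S] [IsManifold 𝓘(ℂ, ℂ × ℂ) ω S]

/-- The difference of two connections, as a tensor. -/
noncomputable def diffTensor (nabla nabla' : AffineConnection S) (p : S) :
    (ℂ × ℂ) →L[ℂ] (ℂ × ℂ) →L[ℂ] (ℂ × ℂ) :=
  haveI : IsManifold 𝓘(ℂ, ℂ × ℂ) (1 + 1) S := .of_le (n := ω) le_top
  IsCovariantDerivativeOn.difference nabla.isCovariantDerivativeOnUniv
    nabla'.isCovariantDerivativeOnUniv p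

lemma diffTensor_apply (nabla nabla' : AffineConnection S) {p : S} {Y : S → ℂ × ℂ}
    (hY : DiffAt Y p) (v : ℂ × ℂ) :
    diffTensor nabla nabla' p (Y p) v =
      (nabla Y p : (ℂ × ℂ) →L[ℂ] (ℂ × ℂ)) v - (nabla' Y p : (ℂ × ℂ) →L[ℂ] (ℂ × ℂ)) v := by
  have : IsManifold 𝓘(ℂ, ℂ × ℂ) (1 + 1) S := .of_le (n := ω) le_top
  exact congrArg (fun T : (ℂ × ℂ) →L[ℂ] (ℂ × ℂ) ↦ T v)
    (IsCovariantDerivativeOn.difference_apply nabla.isCovariantDerivativeOnUniv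
      nabla'.isCovariantDerivativeOnUniv (Set.mem_univ p) hY)

/-- The pullback to `ℂ²` of the difference of two connections. -/
noncomputable def pullTensor (f : ℂ × ℂ → S) (nabla nabla' : AffineConnection S) (x : ℂ × ℂ) :
    (ℂ × ℂ) →ₗ[ℂ] (ℂ × ℂ) →ₗ[ℂ] (ℂ × ℂ) :=
  LinearMap.mk₂ ℂ
    (fun u v ↦ (diffl f x).inverse (diffTensor nabla nabla' (f x) (diffl f x u) (diffl f x v)))
    (by simp) (by simp) (by simp) (by simp)

lemma pullTensor_apply (f : ℂ × ℂ → S) (nabla nabla' : AffineConnection S) (x u v : ℂ × ℂ) :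
    pullTensor f nabla nabla' x u v =
      (diffl f x).inverse (diffTensor nabla nabla' (f x) (diffl f x u) (diffl f x v)) := rfl

variable {f : ℂ × ℂ → S} {nabla nabla' : AffineConnection S} {x : ℂ × ℂ}

lemma diffl_pullTensor
    (hf : IsLocalDiffeomorphAt 𝓘(ℂ, ℂ × ℂ) 𝓘(ℂ, ℂ × ℂ) ω f x) (u v : ℂ × ℂ) :
    diffl f x (pullTensor f nabla nabla' x u v) =
      diffTensor nabla nabla' (f x) (diffl f x u) (diffl f x v) := by
  rw [pullTensor_apply, (diffl_isInvertible hf).self_apply_inverse]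

lemma pullTensor_equivariant {g : ℂ × ℂ → ℂ × ℂ} {L : (ℂ × ℂ) →L[ℂ] (ℂ × ℂ)}
    (hf : IsLocalDiffeomorphAt 𝓘(ℂ, ℂ × ℂ) 𝓘(ℂ, ℂ × ℂ) ω f x)
    (hf' : IsLocalDiffeomorphAt 𝓘(ℂ, ℂ × ℂ) 𝓘(ℂ, ℂ × ℂ) ω f (g x)) (hg : HasFDerivAt g L x)
    (hfg : f ∘ g =ᶠ[𝓝 x] f) (u v : ℂ × ℂ) :
    pullTensor f nabla nabla' (g x) (L u) (L v) = L (pullTensor f nabla nabla' x u v) := by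
  have hd := diffl_eq_comp hf' hg hfg
  have hx : f (g x) = f x := hfg.self_of_nhds
  refine (diffl_isInvertible hf').injective ?_
  have h := diffl_pullTensor (nabla := nabla) (nabla' := nabla') hf u v
  rw [hd] at h
  rw [diffl_pullTensor hf', hx]
  exact h.symm

/-- Both connections satisfy `∇_X Y - ∇_Y X = [X, Y]`; the brackets cancel in the difference. -/
lemma pullTensor_symm (ht : nabla.torsion = 0) (ht' : nabla'.torsion = 0)
    (hf : IsLocalDiffeomorphAt 𝓘(ℂ, ℂ × ℂ) 𝓘(ℂ, ℂ × ℂ) ω f x) (u v : ℂ × ℂ) :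
    pullTensor f nabla nabla' x u v = pullTensor f nabla nabla' x v u := by
  obtain ⟨Y, hY, hYu⟩ := exists_pushField hf (W := fun _ ↦ u) contDiffAt_const
  obtain ⟨Z, hZ, hZv⟩ := exists_pushField hf (W := fun _ ↦ v) contDiffAt_const
  have hY' : DiffAt Y (f x) := hY.mdifferentiableAt (by simp)
  have hZ' : DiffAt Z (f x) := hZ.mdifferentiableAt (by simp)
  rw [CovariantDerivative.torsion_eq_zero_iff] at ht ht'
  rw [pullTensor_apply, pullTensor_apply]
  congr 1
  rw [← hYu.self_of_nhds, ← hZv.self_of_nhds, diffTensor_apply nabla nabla' hY',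
    diffTensor_apply nabla nabla' hZ']
  have e := (ht hZ' hY').trans (ht' hZ' hY').symm
  exact sub_eq_sub_iff_sub_eq_sub.1 e

/-- Covariant derivatives with respect to a holomorphic connection are holomorphic. -/
lemma IsHolomorphic.contMDiffAt (h : IsHolomorphic nabla) {Y Z : S → ℂ × ℂ} {p : S}
    (hY : ContMDiffAt 𝓘(ℂ, ℂ × ℂ) (𝓘(ℂ, ℂ × ℂ).prod 𝓘(ℂ, ℂ × ℂ)) ω
      (fun y ↦ (Bundle.TotalSpace.mk' (ℂ × ℂ) y (Y y) : TangentBundle 𝓘(ℂ, ℂ × ℂ) S)) p)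
    (hZ : ContMDiffAt 𝓘(ℂ, ℂ × ℂ) (𝓘(ℂ, ℂ × ℂ).prod 𝓘(ℂ, ℂ × ℂ)) ω
      (fun y ↦ (Bundle.TotalSpace.mk' (ℂ × ℂ) y (Z y) : TangentBundle 𝓘(ℂ, ℂ × ℂ) S)) p) :
    ContMDiffAt 𝓘(ℂ, ℂ × ℂ) (𝓘(ℂ, ℂ × ℂ).prod 𝓘(ℂ, ℂ × ℂ)) ω
      (fun y ↦ (Bundle.TotalSpace.mk' (ℂ × ℂ) y (nabla Y y (Z y)) :
        TangentBundle 𝓘(ℂ, ℂ × ℂ) S)) p := by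
  obtain ⟨U, hUY, hU, hp⟩ := eventually_nhds_iff.1 ((contMDiffAt_iff_contMDiffAt_nhds (by simp)).1 hY)
  have h1 := (h U hU).contMDiff (σ := Y) (fun y hy ↦ (hUY y hy).contMDiffWithinAt)
  exact (h1.contMDiffAt (hU.mem_nhds hp)).clm_bundle_apply hZ

/-- Pushing the constant fields `u`, `v` forward makes the component a difference of pulled-back
covariant derivatives. -/
lemma contDiffAt_pullTensor (h : IsHolomorphic nabla) (h' : IsHolomorphic nabla')
    (hf : IsLocalDiffeomorphAt 𝓘(ℂ, ℂ × ℂ) 𝓘(ℂ, ℂ × ℂ) ω f x) (u v : ℂ × ℂ) :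
    ContDiffAt ℂ ω (fun y ↦ pullTensor f nabla nabla' y u v) x := by
  obtain ⟨Y, hY, hYu⟩ := exists_pushField hf (W := fun _ ↦ u) contDiffAt_const
  obtain ⟨Z, hZ, hZv⟩ := exists_pushField hf (W := fun _ ↦ v) contDiffAt_const
  have hYd : ∀ᶠ y in 𝓝 x, DiffAt Y (f y) := by
    have := (contMDiffAt_iff_contMDiffAt_nhds (by simp)).1 hY
    filter_upwards [hf.contMDiffAt.continuousAt.eventually this] with y hy
    exact hy.mdifferentiableAt (by simp)
  refine ((contMDiffAt_pullField hf (h.contMDiffAt hY hZ)).sub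
    (contMDiffAt_pullField hf (h'.contMDiffAt hY hZ))).congr_of_eventuallyEq ?_
  filter_upwards [hYu, hZv, hYd] with y hYy hZy hd
  rw [pullTensor_apply, ← hYy, ← hZy, diffTensor_apply nabla nabla' hd]
  exact map_sub (diffl f y).inverse _ _

lemma sameConnection_of_pullTensor
    (hf : IsLocalDiffeomorphOn 𝓘(ℂ, ℂ × ℂ) 𝓘(ℂ, ℂ × ℂ) ω f HC) (hs : Set.SurjOn f HC Set.univ)
    (h : ∀ x ∈ HC, pullTensor f nabla nabla' x = 0) : SameConnection nabla nabla' := by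
  have key : ∀ (Y : S → ℂ × ℂ) (x : ℂ × ℂ), x ∈ HC → DiffAt Y (f x) → ∀ v : ℂ × ℂ,
      (nabla Y (f x) : (ℂ × ℂ) →L[ℂ] (ℂ × ℂ)) v = (nabla' Y (f x) : (ℂ × ℂ) →L[ℂ] (ℂ × ℂ)) v := by
    intro Y x hx hY v
    have hfx : IsLocalDiffeomorphAt 𝓘(ℂ, ℂ × ℂ) 𝓘(ℂ, ℂ × ℂ) ω f x := hf ⟨x, hx⟩
    have h1 := diffl_pullTensor (nabla := nabla) (nabla' := nabla') hfx (pullField f Y x)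
      (pullField f (fun _ ↦ v) x)
    rw [h x hx, diffl_pullField hfx, diffl_pullField hfx, diffTensor_apply nabla nabla' hY] at h1
    exact sub_eq_zero.1 (h1.symm.trans (map_zero (diffl f x)))
  intro Y p hY
  obtain ⟨x, hx, rfl⟩ := hs (Set.mem_univ p)
  exact ContinuousLinearMap.ext (key Y x hx hY)

end Difference

/-! ### Vanishing of equivariant holomorphic tensors. -/

section Tensors
variable {A : ℂ × ℂ → (ℂ × ℂ) →ₗ[ℂ] (ℂ × ℂ) →ₗ[ℂ] (ℂ × ℂ)}

/-- The standard basis of `ℂ²`. -/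
def stdVec : Fin 2 → ℂ × ℂ := ![(1, 0), (0, 1)]

/-- The coordinates on `ℂ²`. -/
noncomputable def coord : Fin 2 → (ℂ × ℂ) →L[ℂ] ℂ :=
  ![ContinuousLinearMap.fst ℂ ℂ ℂ, ContinuousLinearMap.snd ℂ ℂ ℂ]

lemma tensor_eq_zero {B : (ℂ × ℂ) →ₗ[ℂ] (ℂ × ℂ) →ₗ[ℂ] (ℂ × ℂ)}
    (h : ∀ i j k, coord i (B (stdVec j) (stdVec k)) = 0) : B = 0 := by
  have h1 : ∀ j k, B (stdVec j) (stdVec k) = 0 := fun j k ↦ Prod.ext (h 0 j k) (h 1 j k)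
  refine LinearMap.ext fun u ↦ LinearMap.ext fun v ↦ ?_
  have hu : ∀ u : ℂ × ℂ, u = u.1 • stdVec 0 + u.2 • stdVec 1 := fun u ↦ by simp [stdVec]
  rw [hu u, hu v]
  simp [h1, -Fin.isValue]

/-- The diagonal endomorphism of `ℂ²` with given entries. -/
noncomputable def diag (μ : Fin 2 → ℂ) : (ℂ × ℂ) →L[ℂ] (ℂ × ℂ) :=
  (μ 0 • ContinuousLinearMap.fst ℂ ℂ ℂ).prod (μ 1 • ContinuousLinearMap.snd ℂ ℂ ℂ)

lemma diag_stdVec (μ : Fin 2 → ℂ) (j : Fin 2) : diag μ (stdVec j) = μ j • stdVec j := by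
  fin_cases j <;> simp [diag, stdVec]

lemma coord_diag (μ : Fin 2 → ℂ) (i : Fin 2) (v : ℂ × ℂ) :
    coord i (diag μ v) = μ i * coord i v := by
  fin_cases i <;> simp [diag, coord]

/-- The unipotent endomorphism `(w, z) ↦ (w, z + b w)`. -/
noncomputable def shear (b : ℂ) : (ℂ × ℂ) →L[ℂ] (ℂ × ℂ) :=
  (ContinuousLinearMap.fst ℂ ℂ ℂ).prod
    (ContinuousLinearMap.snd ℂ ℂ ℂ + b • ContinuousLinearMap.fst ℂ ℂ ℂ)

/-- Each component is invariant under the translations and is multiplied by `μ i / (μ j * μ k) ≠ 1`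
under `γ₀`; it is constant, hence zero. -/
lemma tensor_eq_zero_of_lattice (hA : ∀ u v, ContDiffOn ℂ ω (fun x ↦ A x u v) HC) {a : Fin 3 → ℝ}
    {b : Fin 3 → ℂ} {α : ℝ} {μ : Fin 2 → ℂ} (hα : 1 < α) (hμ : ∀ i, μ i ≠ 0)
    (hμ' : ∀ i j k, μ i ≠ μ j * μ k) (ha : a ≠ 0)
    (hspan : ∀ z : ℂ, ∃ r : Fin 3 → ℝ, ∑ i, r i * a i = 0 ∧ ∑ i, (r i : ℂ) * b i = z)
    (hi : ∀ i, ∀ w z : ℂ, 0 < w.im → A (w + a i, z + b i) = A (w, z))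
    (h0 : ∀ w z : ℂ, 0 < w.im → ∀ u v,
      A (α * w, μ 1 * z) (diag μ u) (diag μ v) = diag μ (A (w, z) u v))
    {x : ℂ × ℂ} (hx : x ∈ HC) : A x = 0 := by
  refine tensor_eq_zero fun i j k ↦ ?_
  have h0' : ∀ w z : ℂ, 0 < w.im → coord i (A (α * w, μ 1 * z) (stdVec j) (stdVec k)) =
      μ i / (μ j * μ k) * coord i (A (w, z) (stdVec j) (stdVec k)) := fun w z hw ↦ by
    have h := congrArg (coord i) (h0 w z hw (stdVec j) (stdVec k))
    rw [diag_stdVec, diag_stdVec, coord_diag] at h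
    simp only [map_smul, LinearMap.smul_apply, smul_eq_mul] at h
    have hj := hμ j
    have hk := hμ k
    field_simp
    linear_combination h
  have hx' : 0 < ((α : ℂ) * x.1).im := by
    rw [Complex.im_ofReal_mul]
    exact mul_pos (by positivity) hx
  have hc := eq_of_lattice_of_scaling (h := fun x ↦ coord i (A x (stdVec j) (stdVec k)))
    ((coord i).differentiable.comp_differentiableOn ((hA _ _).differentiableOn (by simp)))
    hα (div_ne_zero (hμ i) (mul_ne_zero (hμ j) (hμ k))) ha hspan
    (fun i w z hw ↦ by rw [hi i w z hw]) h0' hx (y := (α * x.1, μ 1 * x.2)) hx'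
  rw [h0' _ _ hx] at hc
  have hne : μ i / (μ j * μ k) ≠ 1 := fun h ↦
    hμ' i j k ((div_eq_one_iff_eq (mul_ne_zero (hμ j) (hμ k))).1 h)
  have : (1 - μ i / (μ j * μ k)) * coord i (A x (stdVec j) (stdVec k)) = 0 := by
    linear_combination hc
  exact (mul_eq_zero.1 this).resolve_left (sub_ne_zero.2 hne.symm)

/-- Let `F i j k` be the `i`-th coordinate of the tensor on the basis vectors `j`, `k`. Shears alter
a component only by components with fewer lower indices `0` or with upper index `0` instead of `1`,
which dictates the order of elimination. -/
lemma tensor_eq_zero_of_heisenberg (hA : ∀ u v, ContDiffOn ℂ ω (fun x ↦ A x u v) HC)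
    (hsymm : ∀ x ∈ HC, ∀ u v, A x u v = A x v u) {a b c : Fin 2 → ℝ} {s α : ℝ} {t : ℂ}
    (hα : 1 < α) (hs : s ≠ 0) (hab : b 0 * a 1 - b 1 * a 0 ≠ 0)
    (hi : ∀ i, ∀ w z : ℂ, 0 < w.im → ∀ u v,
      A (w + a i, z + (b i * w + c i)) (shear (b i) u) (shear (b i) v) =
        shear (b i) (A (w, z) u v))
    (h3 : ∀ w z : ℂ, 0 < w.im → A (w, z + s) = A (w, z))
    (h0 : ∀ w z : ℂ, 0 < w.im → ∀ u v,
      A (α * w, z + t) (diag ![α, 1] u) (diag ![α, 1] v) = diag ![α, 1] (A (w, z) u v))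
    {x : ℂ × ℂ} (hx : x ∈ HC) : A x = 0 := by
  have hα0 : (α : ℂ) ≠ 0 := by exact_mod_cast (by positivity : α ≠ 0)
  have hα1 : (α : ℂ) ≠ 1 := by exact_mod_cast hα.ne'
  have hαw : ∀ w : ℂ, 0 < w.im → 0 < ((α : ℂ) * w).im := fun w hw ↦ by
    rw [Complex.im_ofReal_mul]
    positivity
  have hαn : ‖(α : ℂ)⁻¹‖ ≤ 1 := by
    rw [norm_inv, Complex.norm_real, Real.norm_of_nonneg (by positivity)]
    exact inv_le_one_of_one_le₀ hα.le
  have hI : ((Complex.I, 0) : ℂ × ℂ) ∈ HC := by simp [HC]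
  set F : Fin 2 → Fin 2 → Fin 2 → ℂ × ℂ → ℂ := fun i j k x ↦ coord i (A x (stdVec j) (stdVec k))
    with hF
  have hFd : ∀ i j k, ContDiffOn ℂ ω (F i j k) HC := fun i j k ↦
    (coord i).contDiff.comp_contDiffOn (hA _ _)
  have hF3 : ∀ i j k, ∀ w z : ℂ, 0 < w.im → F i j k (w, z + s) = F i j k (w, z) :=
    fun i j k w z hw ↦ by simp only [hF, h3 w z hw]
  have hF0 : ∀ i j k, ∀ w z : ℂ, 0 < w.im → (![α, 1] : Fin 2 → ℂ) j * (![α, 1] : Fin 2 → ℂ) k *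
      F i j k (α * w, z + t) = (![α, 1] : Fin 2 → ℂ) i * F i j k (w, z) := fun i j k w z hw ↦ by
    have h := congrArg (coord i) (h0 w z hw (stdVec j) (stdVec k))
    rw [diag_stdVec, diag_stdVec, coord_diag] at h
    simp only [map_smul, LinearMap.smul_apply, smul_eq_mul] at h
    rw [← h]
    ring
  have hsymm' : ∀ i, ∀ x ∈ HC, F i 1 0 x = F i 0 1 x := fun i x hx ↦ by
    simp only [hF, hsymm x hx (stdVec 1)]
  have hsh0 : ∀ b : ℂ, shear b (stdVec 0) = stdVec 0 + b • stdVec 1 := fun b ↦ by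
    simp [shear, stdVec]
  have hsh1 : ∀ b : ℂ, shear b (stdVec 1) = stdVec 1 := fun b ↦ by simp [shear, stdVec]
  have hc0 : ∀ (b : ℂ) v, coord 0 (shear b v) = coord 0 v := fun b v ↦ by simp [shear, coord]
  have hc1 : ∀ (b : ℂ) v, coord 1 (shear b v) = coord 1 v + b * coord 0 v := fun b v ↦ by
    simp [shear, coord]
  have hHC : ∀ i, ∀ w z : ℂ, 0 < w.im → (w + a i, z + (b i * w + c i)) ∈ HC := fun i w z hw ↦ by
    simpa [HC] using hw
  -- transformation under the unipotent generators
  have h11 : ∀ i, ∀ w z : ℂ, 0 < w.im →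
      F 0 1 1 (w + a i, z + (b i * w + c i)) = F 0 1 1 (w, z) ∧
      F 1 1 1 (w + a i, z + (b i * w + c i)) = F 1 1 1 (w, z) + b i * F 0 1 1 (w, z) :=
    fun i w z hw ↦ by
      have h := hi i w z hw (stdVec 1) (stdVec 1)
      rw [hsh1] at h
      exact ⟨(congrArg (coord 0) h).trans (hc0 _ _), (congrArg (coord 1) h).trans (hc1 _ _)⟩
  have h01 : ∀ i, ∀ w z : ℂ, 0 < w.im →
      F 0 0 1 (w + a i, z + (b i * w + c i)) + b i * F 0 1 1 (w + a i, z + (b i * w + c i)) =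
        F 0 0 1 (w, z) ∧
      F 1 0 1 (w + a i, z + (b i * w + c i)) + b i * F 1 1 1 (w + a i, z + (b i * w + c i)) =
        F 1 0 1 (w, z) + b i * F 0 0 1 (w, z) := fun i w z hw ↦ by
    have h := hi i w z hw (stdVec 0) (stdVec 1)
    rw [hsh1, hsh0] at h
    have e0 := (congrArg (coord 0) h).trans (hc0 _ _)
    have e1 := (congrArg (coord 1) h).trans (hc1 _ _)
    simp only [map_add, map_smul, LinearMap.add_apply, LinearMap.smul_apply, smul_eq_mul] at e0 e1
    exact ⟨e0, e1⟩
  have h00 : ∀ i, ∀ w z : ℂ, 0 < w.im →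
      F 0 0 0 (w + a i, z + (b i * w + c i)) + 2 * b i * F 0 0 1 (w + a i, z + (b i * w + c i)) +
        b i ^ 2 * F 0 1 1 (w + a i, z + (b i * w + c i)) = F 0 0 0 (w, z) ∧
      F 1 0 0 (w + a i, z + (b i * w + c i)) + 2 * b i * F 1 0 1 (w + a i, z + (b i * w + c i)) +
        b i ^ 2 * F 1 1 1 (w + a i, z + (b i * w + c i)) =
        F 1 0 0 (w, z) + b i * F 0 0 0 (w, z) := fun i w z hw ↦ by
    have h := hi i w z hw (stdVec 0) (stdVec 0)
    rw [hsh0] at h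
    have e0 := (congrArg (coord 0) h).trans (hc0 _ _)
    have e1 := (congrArg (coord 1) h).trans (hc1 _ _)
    simp only [map_add, map_smul, LinearMap.add_apply, LinearMap.smul_apply, smul_eq_mul] at e0 e1
    have s0 := hsymm' 0 _ (hHC i w z hw)
    have s1 := hsymm' 1 _ (hHC i w z hw)
    simp only [hF] at s0 s1 ⊢
    constructor
    · linear_combination e0 - (b i : ℂ) * s0
    · linear_combination e1 - (b i : ℂ) * s1
  -- Such a function is constant, and its value `v` satisfies `v = l * v` with `l ≠ 1`.
  have zero_of : ∀ {h : ℂ × ℂ → ℂ} {l : ℂ}, ContDiffOn ℂ ω h HC → l ≠ 0 → l ≠ 1 →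
      (∀ i, ∀ w z : ℂ, 0 < w.im → h (w + a i, z + (b i * w + c i)) = h (w, z)) →
      (∀ w z : ℂ, 0 < w.im → h (w, z + s) = h (w, z)) →
      (∀ w z : ℂ, 0 < w.im → h (α * w, z + t) = l * h (w, z)) → ∀ x ∈ HC, h x = 0 := by
    intro h l hd hl hl1 hi h3 h0 x hx
    have e := eq_of_heisenberg hd hs hab hi h3 hα hl h0 hx (y := (α * x.1, x.2 + t)) (hαw _ hx)
    rw [h0 _ _ hx] at e
    have : (1 - l) * h x = 0 := by linear_combination e
    exact (mul_eq_zero.1 this).resolve_left (sub_ne_zero.2 hl1.symm)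
  have z011 : ∀ x ∈ HC, F 0 1 1 x = 0 := zero_of (hFd _ _ _) hα0 hα1
    (fun i w z hw ↦ (h11 i w z hw).1) (hF3 _ _ _) (fun w z hw ↦ by simpa using hF0 0 1 1 w z hw)
  -- The components `001` and `111` have weight `1` under `γ₀`, so invariance yields only that they
  -- are constant.
  have c001 : ∀ x ∈ HC, F 0 0 1 x = F 0 0 1 (Complex.I, 0) := fun x hx ↦
    eq_of_heisenberg (hFd _ _ _) hs hab
      (fun i w z hw ↦ by simpa [z011 _ (hHC i w z hw)] using (h01 i w z hw).1) (hF3 _ _ _) hα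
      one_ne_zero (t := t) (fun w z hw ↦ by simpa [hα0] using hF0 0 0 1 w z hw) hx hI
  have c111 : ∀ x ∈ HC, F 1 1 1 x = F 1 1 1 (Complex.I, 0) := fun x hx ↦
    eq_of_heisenberg (c := c) (hFd _ _ _) hs hab
      (fun i w z hw ↦ by simpa [z011 (w, z) hw] using (h11 i w z hw).2)
      (hF3 _ _ _) hα one_ne_zero (t := t) (fun w z hw ↦ by simpa using hF0 1 1 1 w z hw) hx hI
  have s000 : ∀ w z : ℂ, 0 < w.im → F 0 0 0 (α * w, z + t) = (α : ℂ)⁻¹ * F 0 0 0 (w, z) :=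
    fun w z hw ↦ by
      have h := hF0 0 0 0 w z hw
      simp only [Matrix.cons_val_zero] at h
      field_simp
      exact mul_left_cancel₀ hα0 (by linear_combination h)
  -- The constant `2 * F 0 0 1` is the shift of `F 0 0 0` under the shears, and `F 0 0 0` has weight
  -- `α⁻¹` of norm at most `1`.
  have z001 : F 0 0 1 (Complex.I, 0) = 0 := by
    have := eq_zero_of_heisenberg (C := 2 * F 0 0 1 (Complex.I, 0)) (c := c) (hFd 0 0 0) hs hab
      (fun i w z hw ↦ by
        have h := (h00 i w z hw).1
        rw [z011 _ (hHC i w z hw), c001 _ (hHC i w z hw)] at h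
        linear_combination h) (hF3 _ _ _) hα (inv_ne_zero hα0) hαn s000
    simpa using this
  have z000 : ∀ x ∈ HC, F 0 0 0 x = 0 := zero_of (hFd _ _ _) (inv_ne_zero hα0) (inv_ne_one.2 hα1)
    (fun i w z hw ↦ by
      have h := (h00 i w z hw).1
      rw [z011 _ (hHC i w z hw), c001 _ (hHC i w z hw), z001] at h
      linear_combination h) (hF3 _ _ _) s000
  have s101 : ∀ w z : ℂ, 0 < w.im → F 1 0 1 (α * w, z + t) = (α : ℂ)⁻¹ * F 1 0 1 (w, z) :=
    fun w z hw ↦ by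
      have h := hF0 1 0 1 w z hw
      simp only [Matrix.cons_val_zero, Matrix.cons_val_one, mul_one, one_mul] at h
      rw [← h, inv_mul_cancel_left₀ hα0]
  -- In the same way `F 1 1 1` is the shift of `F 1 0 1`, whose weight is `α⁻¹`.
  have z111 : F 1 1 1 (Complex.I, 0) = 0 :=
    eq_zero_of_heisenberg (c := c) (hFd 1 0 1) hs hab
      (fun i w z hw ↦ by
        have h := (h01 i w z hw).2
        rw [c001 (w, z) hw, z001, c111 _ (hHC i w z hw)] at h
        linear_combination h) (hF3 _ _ _) hα (inv_ne_zero hα0) hαn s101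
  have z101 : ∀ x ∈ HC, F 1 0 1 x = 0 := zero_of (hFd _ _ _) (inv_ne_zero hα0) (inv_ne_one.2 hα1)
    (fun i w z hw ↦ by
      have h := (h01 i w z hw).2
      rw [c001 (w, z) hw, z001, c111 _ (hHC i w z hw), z111] at h
      linear_combination h) (hF3 _ _ _) s101
  have hα2 : ((α : ℂ) ^ 2)⁻¹ ≠ 1 := by
    have : α ^ 2 ≠ 1 := (one_lt_pow₀ hα two_ne_zero).ne'
    exact inv_ne_one.2 (by exact_mod_cast this)
  have z100 : ∀ x ∈ HC, F 1 0 0 x = 0 := zero_of (hFd _ _ _) (inv_ne_zero (pow_ne_zero 2 hα0)) hα2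
    (fun i w z hw ↦ by
      have h := (h00 i w z hw).2
      rw [z101 _ (hHC i w z hw), c111 _ (hHC i w z hw), z111, z000 (w, z) hw] at h
      linear_combination h) (hF3 _ _ _)
    (fun w z hw ↦ by
      have h := hF0 1 0 0 w z hw
      simp only [Matrix.cons_val_zero, Matrix.cons_val_one, one_mul] at h
      rw [← h, ← sq, inv_mul_cancel_left₀ (pow_ne_zero 2 hα0)])
  refine tensor_eq_zero fun i j k ↦ ?_
  change F i j k x = 0
  fin_cases i <;> fin_cases j <;> fin_cases k
  exacts [z000 x hx, (c001 x hx).trans z001, (hsymm' 0 x hx).trans ((c001 x hx).trans z001),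
    z011 x hx, z100 x hx, z101 x hx, (hsymm' 1 x hx).trans (z101 x hx), (c111 x hx).trans z111]

end Tensors

/-! ### Affinity of the groups `Γ` and the arithmetic of their data. -/

section Groups

/-- The endomorphism `diag μ` as an equivalence. -/
noncomputable def diagEquiv (μ : Fin 2 → ℂ) (hμ : ∀ i, μ i ≠ 0) : (ℂ × ℂ) ≃L[ℂ] (ℂ × ℂ) :=
  ContinuousLinearEquiv.equivOfInverse (diag μ) (diag fun i ↦ (μ i)⁻¹)
    (fun x ↦ by simp [diag, hμ]) (fun x ↦ by simp [diag, hμ])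

/-- The endomorphism `shear b` as an equivalence. -/
noncomputable def shearEquiv (b : ℂ) : (ℂ × ℂ) ≃L[ℂ] (ℂ × ℂ) :=
  ContinuousLinearEquiv.equivOfInverse (shear b) (shear (-b))
    (fun x ↦ by simp [shear]) (fun x ↦ by simp [shear])

/-- The permutation `g` is an affine transformation preserving `HC`. -/
def IsAffineOfHC (g : Equiv.Perm (ℂ × ℂ)) : Prop :=
  ∃ (L : (ℂ × ℂ) ≃L[ℂ] (ℂ × ℂ)) (c : ℂ × ℂ), (∀ x, g x = L x + c) ∧ ∀ x, g x ∈ HC ↔ x ∈ HC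

lemma isAffineOfHC_of_mem_closure {s : Set (Equiv.Perm (ℂ × ℂ))} (hs : ∀ g ∈ s, IsAffineOfHC g)
    {g : Equiv.Perm (ℂ × ℂ)} (hg : g ∈ Subgroup.closure s) : IsAffineOfHC g := by
  induction hg using Subgroup.closure_induction with
  | mem g hg => exact hs g hg
  | one => exact ⟨.refl ℂ _, 0, by simp, by simp⟩
  | mul g h _ _ ihg ihh =>
    obtain ⟨L, c, h1, h2⟩ := ihg
    obtain ⟨L', c', h1', h2'⟩ := ihh
    refine ⟨L'.trans L, L c' + c, fun x ↦ ?_, fun x ↦ ?_⟩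
    · simp [h1, h1', add_assoc]
    · rw [Equiv.Perm.mul_apply, h2, h2']
  | inv g _ ih =>
    obtain ⟨L, c, h1, h2⟩ := ih
    refine ⟨L.symm, -L.symm c, fun x ↦ ?_, fun x ↦ ?_⟩
    · rw [Equiv.Perm.inv_eq_iff_eq, h1]
      simp
    · rw [← h2]
      simp

lemma isAffineOfHC_diag {g : Equiv.Perm (ℂ × ℂ)} {α : ℝ} {β t : ℂ} (hα : 0 < α) (hβ : β ≠ 0)
    (hg : ∀ w z : ℂ, g (w, z) = (α * w, β * z + t)) : IsAffineOfHC g := by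
  have hμ : ∀ i, (![(α : ℂ), β] : Fin 2 → ℂ) i ≠ 0 := fun i ↦ by
    fin_cases i
    · simpa using hα.ne'
    · simpa using hβ
  refine ⟨diagEquiv _ hμ, (0, t), fun x ↦ ?_, fun x ↦ ?_⟩
  · rw [show x = (x.1, x.2) from rfl, hg]
    simp [diagEquiv, diag]
  · rw [show x = (x.1, x.2) from rfl, hg]
    simp [HC, hα]

lemma isAffineOfHC_shear {g : Equiv.Perm (ℂ × ℂ)} {a : ℝ} {b c : ℂ}
    (hg : ∀ w z : ℂ, g (w, z) = (w + a, z + (b * w + c))) : IsAffineOfHC g := by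
  refine ⟨shearEquiv b, (a, c), fun x ↦ ?_, fun x ↦ ?_⟩
  · rw [show x = (x.1, x.2) from rfl, hg]
    simp [shearEquiv, shear, add_assoc]
  · rw [show x = (x.1, x.2) from rfl, hg]
    simp [HC]

/-- `Γ` is generated by whichever permutations satisfy given formulas, so using a generator requires
exhibiting a permutation with its formula. -/
lemma exists_perm_diag {α β t : ℂ} (hα : α ≠ 0) (hβ : β ≠ 0) :
    ∃ g : Equiv.Perm (ℂ × ℂ), ∀ w z : ℂ, g (w, z) = (α * w, β * z + t) :=
  ⟨⟨fun x ↦ (α * x.1, β * x.2 + t), fun x ↦ (α⁻¹ * x.1, β⁻¹ * (x.2 - t)),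
    fun x ↦ by simp [hα, hβ], fun x ↦ by simp [hα, hβ]⟩, fun _ _ ↦ rfl⟩

lemma exists_perm_shear (a b c : ℂ) :
    ∃ g : Equiv.Perm (ℂ × ℂ), ∀ w z : ℂ, g (w, z) = (w + a, z + (b * w + c)) :=
  ⟨⟨fun x ↦ (x.1 + a, x.2 + (b * x.1 + c)), fun x ↦ (x.1 - a, x.2 - (b * (x.1 - a) + c)),
    fun x ↦ by simp, fun x ↦ by simp⟩, fun _ _ ↦ rfl⟩

lemma hasFDerivAt_diag (α β t : ℂ) (x : ℂ × ℂ) :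
    HasFDerivAt (fun x : ℂ × ℂ ↦ (α * x.1, β * x.2 + t)) (diag ![α, β]) x := by
  have h := ((diag ![α, β]).hasFDerivAt (x := x)).add_const (0, t)
  refine h.congr_of_eventuallyEq (Filter.Eventually.of_forall fun y ↦ ?_)
  simp [diag]

lemma hasFDerivAt_shear (a b c : ℂ) (x : ℂ × ℂ) :
    HasFDerivAt (fun x : ℂ × ℂ ↦ (x.1 + a, x.2 + (b * x.1 + c))) (shear b) x := by
  have h := ((shear b).hasFDerivAt (x := x)).add_const (a, c)
  refine h.congr_of_eventuallyEq (Filter.Eventually.of_forall fun y ↦ ?_)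
  simp [shear, add_assoc]

namespace SMData
variable (D : SMData)

lemma β_ne_zero : D.β ≠ 0 := fun h ↦ D.nonreal (by simp [h])

lemma isAffineOfHC {g : Equiv.Perm (ℂ × ℂ)} (hg : g ∈ D.Γ) : IsAffineOfHC g := by
  refine isAffineOfHC_of_mem_closure ?_ hg
  rintro g (hg | ⟨i, hg⟩)
  · exact isAffineOfHC_diag (zero_lt_one.trans D.one_lt) D.β_ne_zero (t := 0) (by simpa using hg)
  · exact isAffineOfHC_shear (b := 0) (by simpa using hg)

/-- Equality would force `α = 1`, `β` real, or `α = β ^ 2`; in the last case `β` is purely imaginary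
and `β ^ 2 < 0`. -/
lemma eigenvalue_ne_mul (i j k : Fin 2) :
    (![(D.α : ℂ), D.β] : Fin 2 → ℂ) i ≠
      (![(D.α : ℂ), D.β] : Fin 2 → ℂ) j * (![(D.α : ℂ), D.β] : Fin 2 → ℂ) k := by
  have hα := D.one_lt
  have hβ : D.β.im ≠ 0 := fun h ↦ D.nonreal (Complex.conj_eq_iff_im.2 h).symm
  intro h
  have hre := congrArg Complex.re h
  have him := congrArg Complex.im h
  fin_cases i <;> fin_cases j <;> fin_cases k <;> simp at hre him
  · nlinarith
  · rcases him with him | him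
    · linarith
    · exact hβ him
  · rcases him with him | him
    · exact hβ him
    · linarith
  · have : D.β.re = 0 := mul_right_cancel₀ hβ (by linarith)
    nlinarith
  · exact hβ him
  · exact hα.ne (mul_right_cancel₀ hβ (by linarith))
  · exact hα.ne (mul_right_cancel₀ hβ (by linarith))
  · have : D.β.re = 1 / 2 := mul_right_cancel₀ hβ (by linarith)
    nlinarith

/-- The vectors `a`, `b`, `conj b` belong to distinct eigenvalues. A real `r` annihilated by `a` and
`b` is also annihilated by `conj b`, hence is zero; so the map `ℝ³ → ℝ × ℂ` is injective between
spaces of equal dimension. -/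
lemma exists_real_combination (z : ℂ) :
    ∃ r : Fin 3 → ℝ, ∑ i, r i * D.a i = 0 ∧ ∑ i, (r i : ℂ) * D.b i = z := by
  set M : Matrix (Fin 3) (Fin 3) ℂ := D.M.1.map (Int.cast : ℤ → ℂ) with hM
  let v : Fin 3 → Fin 3 → ℂ :=
    ![fun i ↦ (D.a i : ℂ), D.b, fun i ↦ (starRingEnd ℂ) (D.b i)]
  have hβ : D.β.im ≠ 0 := fun h ↦ D.nonreal (Complex.conj_eq_iff_im.2 h).symm
  have hv : LinearIndependent ℂ v := by
    refine Module.End.eigenvectors_linearIndependent' (Matrix.toLin' M)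
      ![(D.α : ℂ), D.β, (starRingEnd ℂ) D.β] ?_ v fun i ↦ ?_
    · intro i j hij
      have hne : (D.α : ℂ) ≠ D.β := fun h ↦ hβ (by rw [← h]; simp)
      have hne' : (D.α : ℂ) ≠ (starRingEnd ℂ) D.β := fun h ↦ hβ (by
        have := congrArg Complex.im h
        simpa using this)
      fin_cases i <;> fin_cases j <;> simp [hne, hne', D.nonreal, hne.symm, hne'.symm,
        D.nonreal.symm] at hij ⊢
    · rw [Module.End.hasEigenvector_iff, Module.End.mem_eigenspace_iff, Matrix.toLin'_apply]
      fin_cases i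
      · refine ⟨funext fun j ↦ ?_, fun h ↦ D.a_ne (funext fun j ↦ ?_)⟩
        · have := congrArg (fun x : ℝ ↦ (x : ℂ)) (congrFun D.eigen_a j)
          simpa [Matrix.mulVec, dotProduct, v, M] using this
        · simpa [v] using congrFun h j
      · exact ⟨D.eigen_b, D.b_ne⟩
      · refine ⟨funext fun j ↦ ?_, fun h ↦ D.b_ne (funext fun j ↦ ?_)⟩
        · have := congrArg (starRingEnd ℂ) (congrFun D.eigen_b j)
          simpa [Matrix.mulVec, dotProduct, v, M] using this
        · simpa [v] using congrFun h j
  have hunit : IsUnit (Matrix.of v) := Matrix.linearIndependent_rows_iff_isUnit.1 hv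
  let T : (Fin 3 → ℝ) →ₗ[ℝ] ℝ × ℂ :=
    { toFun := fun r ↦ (∑ i, r i * D.a i, ∑ i, (r i : ℂ) * D.b i)
      map_add' := fun r s ↦ by simp [add_mul, Finset.sum_add_distrib]
      map_smul' := fun c r ↦ by simp [mul_assoc, Finset.mul_sum] }
  have hT : Function.Injective T := by
    rw [injective_iff_map_eq_zero]
    intro r hr
    have h1 : ∑ i, r i * D.a i = 0 := congrArg Prod.fst hr
    have h2 : ∑ i, (r i : ℂ) * D.b i = 0 := congrArg Prod.snd hr
    have h3 : Matrix.of v *ᵥ (fun i ↦ (r i : ℂ)) = 0 := by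
      funext j
      fin_cases j
      · have := congrArg (fun x : ℝ ↦ (x : ℂ)) h1
        simpa [Matrix.mulVec, dotProduct, v, mul_comm] using this
      · simpa [Matrix.mulVec, dotProduct, v, mul_comm] using h2
      · have := congrArg (starRingEnd ℂ) h2
        simpa [Matrix.mulVec, dotProduct, v, mul_comm] using this
    have h4 := Matrix.mulVec_injective_of_isUnit hunit (h3.trans (Matrix.mulVec_zero _).symm)
    funext i
    simpa using congrFun h4 i
  have hT' : Function.Surjective T := by
    refine (LinearMap.injective_iff_surjective_of_finrank_eq_finrank ?_).1 hT
    simp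
  obtain ⟨r, hr⟩ := hT' (0, z)
  exact ⟨r, congrArg Prod.fst hr, congrArg Prod.snd hr⟩

end SMData

namespace SPlusData
variable (D : SPlusData)

lemma isAffineOfHC {g : Equiv.Perm (ℂ × ℂ)} (hg : g ∈ D.Γ) : IsAffineOfHC g := by
  refine isAffineOfHC_of_mem_closure ?_ hg
  rintro g (hg | ⟨i, hg⟩ | hg)
  · exact isAffineOfHC_diag (zero_lt_one.trans D.one_lt) one_ne_zero (t := D.t) (by simpa using hg)
  · exact isAffineOfHC_shear (b := D.b i) (c := D.c i) (by simpa [add_assoc] using hg)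
  · exact isAffineOfHC_shear (a := 0) (b := 0) (by simpa using hg)

lemma det_ne_zero : D.b 0 * D.a 1 - D.b 1 * D.a 0 ≠ 0 := by
  intro h
  have hα := D.one_lt
  have hα0 : D.α ≠ 0 := by positivity
  have hne : D.α - D.α⁻¹ ≠ 0 := by
    have := inv_lt_one_of_one_lt₀ hα
    linarith
  have ha : ∀ i, (D.N.1 i 0 : ℝ) * D.a 0 + D.N.1 i 1 * D.a 1 = D.α * D.a i := fun i ↦ by
    simpa [Matrix.mulVec, dotProduct, Fin.sum_univ_two] using congrFun D.eigen_a i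
  have hb : ∀ i, (D.N.1 i 0 : ℝ) * D.b 0 + D.N.1 i 1 * D.b 1 = D.α⁻¹ * D.b i := fun i ↦ by
    simpa [Matrix.mulVec, dotProduct, Fin.sum_univ_two] using congrFun D.eigen_b i
  have hab : ∀ i j, D.b i * D.a j = D.a i * D.b j := fun i j ↦ by
    fin_cases i <;> fin_cases j <;> simp <;> linarith
  have hz : ∀ i j, D.b i * D.a j = 0 := fun i j ↦ by
    -- If `b ⊗ a = a ⊗ b`, applying `N` to the second factor multiplies one side by `α` and the
    -- other by `α⁻¹`.
    have : (D.α - D.α⁻¹) * (D.b i * D.a j) = 0 := by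
      linear_combination (-D.b i) * ha j + D.a i * hb j + (D.N.1 j 0 : ℝ) * hab i 0 +
        (D.N.1 j 1 : ℝ) * hab i 1 - D.α⁻¹ * hab i j
    exact (mul_eq_zero.1 this).resolve_left hne
  obtain ⟨i, hi⟩ := Function.ne_iff.1 D.b_ne
  obtain ⟨j, hj⟩ := Function.ne_iff.1 D.a_ne
  exact mul_ne_zero hi hj (hz i j)

end SPlusData
end Groups

/-! ### Uniqueness for any `Γ`-invariant uniformization. -/

section Uniqueness
variable {S : Type u} [TopologicalSpace S] [ChartedSpace (ℂ × ℂ) S] [IsManifold 𝓘(ℂ, ℂ × ℂ) ω S]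
  {f : ℂ × ℂ → S} {nabla nabla' : AffineConnection S}

/-- The groups `Γ` of the surfaces `S_M` and `S⁺_{N,p,q,r,t}`. -/
def IsInoueGroup (Γ : Subgroup (Equiv.Perm (ℂ × ℂ))) : Prop :=
  (∃ D : SMData, Γ = D.Γ) ∨ ∃ D : SPlusData, Γ = D.Γ

lemma IsInoueGroup.isAffineOfHC {Γ : Subgroup (Equiv.Perm (ℂ × ℂ))} (hΓ : IsInoueGroup Γ)
    {g : Equiv.Perm (ℂ × ℂ)} (hg : g ∈ Γ) : IsAffineOfHC g := by
  obtain ⟨D, rfl⟩ | ⟨D, rfl⟩ := hΓ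
  exacts [D.isAffineOfHC hg, D.isAffineOfHC hg]

lemma pullTensor_equivariant_of_mem
    (hf : IsLocalDiffeomorphOn 𝓘(ℂ, ℂ × ℂ) 𝓘(ℂ, ℂ × ℂ) ω f HC)
    {Γ : Subgroup (Equiv.Perm (ℂ × ℂ))} (hΓ : IsInoueGroup Γ)
    (hinv : ∀ g ∈ Γ, ∀ x ∈ HC, f (g x) = f x) {g : Equiv.Perm (ℂ × ℂ)} (hg : g ∈ Γ) {x : ℂ × ℂ}
    (hx : x ∈ HC) {L : (ℂ × ℂ) →L[ℂ] (ℂ × ℂ)} (hL : HasFDerivAt g L x) (u v : ℂ × ℂ) :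
    pullTensor f nabla nabla' (g x) (L u) (L v) = L (pullTensor f nabla nabla' x u v) := by
  obtain ⟨-, -, -, hgH⟩ := hΓ.isAffineOfHC hg
  exact pullTensor_equivariant (hf ⟨x, hx⟩) (hf ⟨g x, (hgH x).2 hx⟩) hL
    (Filter.eventuallyEq_of_mem (isOpen_HC.mem_nhds hx) (hinv g hg)) u v

/-- Holomorphic torsion-free connections on a quotient of an Inoue surface agree. -/
theorem sameConnection_of_isInoueGroup
    (hf : IsLocalDiffeomorphOn 𝓘(ℂ, ℂ × ℂ) 𝓘(ℂ, ℂ × ℂ) ω f HC) (hs : Set.SurjOn f HC Set.univ)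
    {Γ : Subgroup (Equiv.Perm (ℂ × ℂ))} (hΓ : IsInoueGroup Γ)
    (hinv : ∀ g ∈ Γ, ∀ x ∈ HC, f (g x) = f x) (h : IsHolomorphic nabla)
    (h' : IsHolomorphic nabla') (ht : nabla.torsion = 0) (ht' : nabla'.torsion = 0) :
    SameConnection nabla nabla' := by
  refine sameConnection_of_pullTensor hf hs fun x hx ↦ ?_
  have hA : ∀ u v, ContDiffOn ℂ ω (fun x ↦ pullTensor f nabla nabla' x u v) HC :=
    fun u v x hx ↦ (contDiffAt_pullTensor h h' (hf ⟨x, hx⟩) u v).contDiffWithinAt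
  have hdiag : ∀ {α β t : ℂ} {g : Equiv.Perm (ℂ × ℂ)}, g ∈ Γ →
      (∀ w z : ℂ, g (w, z) = (α * w, β * z + t)) → ∀ w z : ℂ, 0 < w.im → ∀ u v,
      pullTensor f nabla nabla' (α * w, β * z + t) (diag ![α, β] u) (diag ![α, β] v) =
        diag ![α, β] (pullTensor f nabla nabla' (w, z) u v) := fun hg hgf w z hw u v ↦ by
    have hgd := (hasFDerivAt_diag _ _ _ (w, z)).congr_of_eventuallyEq
      (Filter.Eventually.of_forall fun y ↦ hgf y.1 y.2)
    have := pullTensor_equivariant_of_mem (nabla := nabla) (nabla' := nabla') hf hΓ hinv hg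
      (x := (w, z)) hw hgd u v
    rwa [hgf] at this
  have hshear : ∀ {a b c : ℂ} {g : Equiv.Perm (ℂ × ℂ)}, g ∈ Γ →
      (∀ w z : ℂ, g (w, z) = (w + a, z + (b * w + c))) → ∀ w z : ℂ, 0 < w.im → ∀ u v,
      pullTensor f nabla nabla' (w + a, z + (b * w + c)) (shear b u) (shear b v) =
        shear b (pullTensor f nabla nabla' (w, z) u v) := fun hg hgf w z hw u v ↦ by
    have hgd := (hasFDerivAt_shear _ _ _ (w, z)).congr_of_eventuallyEq
      (Filter.Eventually.of_forall fun y ↦ hgf y.1 y.2)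
    have := pullTensor_equivariant_of_mem (nabla := nabla) (nabla' := nabla') hf hΓ hinv hg
      (x := (w, z)) hw hgd u v
    rwa [hgf] at this
  have hshear0 : ∀ v, shear 0 v = v := fun v ↦ by simp [shear]
  obtain ⟨D, rfl⟩ | ⟨D, rfl⟩ := hΓ
  · have hα : (D.α : ℂ) ≠ 0 := by exact_mod_cast (zero_lt_one.trans D.one_lt).ne'
    refine tensor_eq_zero_of_lattice (μ := ![(D.α : ℂ), D.β]) hA D.one_lt (fun i ↦ ?_)
      D.eigenvalue_ne_mul D.a_ne D.exists_real_combination (fun i w z hw ↦ ?_)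
      (fun w z hw u v ↦ ?_) hx
    · fin_cases i
      exacts [hα, D.β_ne_zero]
    -- A translation is the shear with slope `0`, whose linear part is the identity.
    · obtain ⟨g, hg⟩ := exists_perm_shear (D.a i) 0 (D.b i)
      have := hshear (Subgroup.subset_closure (Or.inr ⟨i, by simpa using hg⟩)) hg w z hw
      refine LinearMap.ext fun u ↦ LinearMap.ext fun v ↦ ?_
      simpa [hshear0] using this u v
    · obtain ⟨g, hg⟩ := exists_perm_diag (t := 0) hα D.β_ne_zero
      simpa using hdiag (Subgroup.subset_closure (Or.inl (by simpa using hg))) hg w z hw u v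
  · have hα : (D.α : ℂ) ≠ 0 := by exact_mod_cast (zero_lt_one.trans D.one_lt).ne'
    have hr : (D.r : ℝ) ≠ 0 := by exact_mod_cast D.r_ne
    refine tensor_eq_zero_of_heisenberg (a := D.a) (b := D.b) (c := D.c) (t := D.t) hA
      (fun x hx u v ↦ pullTensor_symm ht ht' (hf ⟨x, hx⟩) u v) D.one_lt
      (mul_ne_zero (inv_ne_zero hr) D.det_ne_zero) D.det_ne_zero (fun i w z hw u v ↦ ?_)
      (fun w z hw ↦ ?_) (fun w z hw u v ↦ ?_) hx
    · obtain ⟨g, hg⟩ := exists_perm_shear (D.a i) (D.b i) (D.c i)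
      exact hshear (Subgroup.subset_closure (Or.inr (Or.inl ⟨i, by simpa [add_assoc] using hg⟩)))
        hg w z hw u v
    · obtain ⟨g, hg⟩ := exists_perm_shear 0 0
        (((D.r : ℝ)⁻¹ * (D.b 0 * D.a 1 - D.b 1 * D.a 0) : ℝ) : ℂ)
      have := hshear (Subgroup.subset_closure (Or.inr (Or.inr (by simpa using hg)))) hg w z hw
      refine LinearMap.ext fun u ↦ LinearMap.ext fun v ↦ ?_
      simpa [hshear0] using this u v
    · obtain ⟨g, hg⟩ := exists_perm_diag (t := D.t) hα one_ne_zero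
      simpa using hdiag (Subgroup.subset_closure (Or.inl (by simpa using hg))) hg w z hw u v

end Uniqueness

/-! ### Existence on `S_M` and `S⁺`. -/

section Quotients
variable {S : Type u} [TopologicalSpace S] [ChartedSpace (ℂ × ℂ) S] {f : ℂ × ℂ → S}

lemma isInoueQuotient_iff :
    IsInoueQuotient f ↔ ∃ Γ, IsInoueGroup Γ ∧ IsQuotientBy Γ f := by
  constructor
  · rintro (⟨D, h⟩ | ⟨D, h⟩)
    exacts [⟨_, Or.inl ⟨D, rfl⟩, h⟩, ⟨_, Or.inr ⟨D, rfl⟩, h⟩]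
  · rintro ⟨_, ⟨D, rfl⟩ | ⟨D, rfl⟩, h⟩
    exacts [Or.inl ⟨D, h⟩, Or.inr ⟨D, h⟩]

variable {Γ : Subgroup (Equiv.Perm (ℂ × ℂ))}

lemma IsQuotientBy.apply_eq (h : IsQuotientBy Γ f) (hΓ : IsInoueGroup Γ) {g : Equiv.Perm (ℂ × ℂ)}
    (hg : g ∈ Γ) {x : ℂ × ℂ} (hx : x ∈ HC) : f (g x) = f x := by
  obtain ⟨-, -, -, hgH⟩ := hΓ.isAffineOfHC hg
  exact ((h.fibre x hx _ ((hgH x).2 hx)).2 ⟨g, hg, rfl⟩).symm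

/-- The standard connection descends to the quotients of `H × ℂ`. -/
lemma IsQuotientBy.exists_connection [IsManifold 𝓘(ℂ, ℂ × ℂ) ω S] (h : IsQuotientBy Γ f)
    (hΓ : IsInoueGroup Γ) :
    ∃ nabla : AffineConnection S, IsHolomorphic nabla ∧ nabla.torsion = 0 ∧
      PullsBackToStandard f HC nabla ∧ IsFlat nabla := by
  refine Inoue.exists_connection h.isLocalDiffeomorphOn h.surjOn fun x hx y hy hxy Y hY ↦ ?_
  obtain ⟨g, hg, rfl⟩ := (h.fibre x hx y hy).1 hxy
  obtain ⟨L, c, hgL, hgH⟩ := hΓ.isAffineOfHC hg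
  refine pushDeriv_eq_of_affine hgL ?_ ?_ hY
  · filter_upwards [isOpen_HC.mem_nhds hx] with z hz
    exact h.isLocalDiffeomorphOn ⟨g z, (hgH z).2 hz⟩
  · exact Filter.eventuallyEq_of_mem (isOpen_HC.mem_nhds hx) fun z hz ↦ h.apply_eq hΓ hg hz

end Quotients

/-! ### The deck involution of a double cover. -/

section DoubleCovers

lemma isLocalDiffeomorphAt_congr {M N : Type*} [TopologicalSpace M] [ChartedSpace (ℂ × ℂ) M]
    [TopologicalSpace N] [ChartedSpace (ℂ × ℂ) N] {f g : M → N} {x : M}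
    (hf : IsLocalDiffeomorphAt 𝓘(ℂ, ℂ × ℂ) 𝓘(ℂ, ℂ × ℂ) ω f x) (hfg : f =ᶠ[𝓝 x] g) :
    IsLocalDiffeomorphAt 𝓘(ℂ, ℂ × ℂ) 𝓘(ℂ, ℂ × ℂ) ω g x := by
  obtain ⟨Φ, hx, hΦ⟩ := hf
  obtain ⟨U, hU, hUo, hxU⟩ := eventually_nhds_iff.1 hfg
  let e := Φ.toOpenPartialHomeomorph.restrOpen U hUo
  have hs : e.source = Φ.source ∩ U := rfl
  refine ⟨⟨e.toPartialEquiv, e.open_source, e.open_target,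
    Φ.contMDiffOn_toFun.mono Set.inter_subset_left,
    Φ.contMDiffOn_invFun.mono Set.inter_subset_left⟩, ⟨hx, hxU⟩, fun y hy ↦ ?_⟩
  exact (hU y hy.2).symm.trans (hΦ hy.1)

variable {S S' : Type u}

lemma exists_swap {q : S' → S} (hq : ∀ y, (q ⁻¹' {y}).ncard = 2) :
    ∃ σ : S' → S', ∀ p, σ p ≠ p ∧ q (σ p) = q p ∧ ∀ p', q p' = q p → p' = p ∨ p' = σ p := by
  have : ∀ p, ∃ p', p' ≠ p ∧ q p' = q p ∧ ∀ p'', q p'' = q p → p'' = p ∨ p'' = p' := by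
    intro p
    obtain ⟨x, y, hxy, h⟩ := Set.ncard_eq_two.1 (hq (q p))
    have hmem : ∀ p', q p' = q p ↔ p' = x ∨ p' = y := fun p' ↦ by
      rw [← Set.mem_singleton_iff, ← Set.mem_preimage, h]
      rfl
    rcases (hmem p).1 rfl with rfl | rfl
    · exact ⟨y, hxy.symm, (hmem y).2 (Or.inr rfl), fun p'' h ↦ (hmem p'').1 h⟩
    · exact ⟨x, hxy, (hmem x).2 (Or.inl rfl), fun p'' h ↦ ((hmem p'').1 h).symm⟩
  choose σ hσ using this
  exact ⟨σ, hσ⟩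

lemma swap_swap {q : S' → S} {σ : S' → S'}
    (hσ : ∀ p, σ p ≠ p ∧ q (σ p) = q p ∧ ∀ p', q p' = q p → p' = p ∨ p' = σ p)
    (p : S') : σ (σ p) = p :=
  (((hσ p).2.2 _ ((hσ (σ p)).2.1.trans (hσ p).2.1)).resolve_right (hσ (σ p)).1)

variable [TopologicalSpace S] [TopologicalSpace S'] {q : S' → S} {σ : S' → S'}

/-- Over an evenly covered neighbourhood, `σ` sends a point of the sheet of `p` to the point with
the same image in the sheet of `σ p`. -/
lemma continuousAt_swap
    (hσ : ∀ p, σ p ≠ p ∧ q (σ p) = q p ∧ ∀ p', q p' = q p → p' = p ∨ p' = σ p)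
    (hq : IsCoveringMap q) (p : S') : ContinuousAt σ p := by
  have : Nonempty (q ⁻¹' {q p}) := ⟨⟨p, rfl⟩⟩
  have hev := hq (q p)
  have := hev.1
  let e := hev.toTrivialization
  have hp : q p ∈ e.baseSet := hev.mem_toTrivialization_baseSet
  have hbase : ∀ᶠ s in 𝓝 p, q s ∈ e.baseSet :=
    hq.continuous.continuousAt.eventually (e.open_baseSet.mem_nhds hp)
  have hpe : p ∈ e.source := e.mem_source.2 hp
  have hcont : ContinuousAt (fun s ↦ (e s).2) p :=
    continuous_snd.continuousAt.comp (e.continuousAt hpe)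
  have hne : (e p).2 ≠ (e (σ p)).2 := fun h ↦ (hσ p).1 (by
    have hσe : σ p ∈ e.source := e.mem_source.2 (by rwa [(hσ p).2.1])
    exact (e.injOn hpe hσe (Prod.ext
      ((e.coe_fst hpe).trans ((hσ p).2.1.symm.trans (e.coe_fst hσe).symm)) h)).symm)
  have hlocal : σ =ᶠ[𝓝 p] fun s ↦ e.toOpenPartialHomeomorph.symm (q s, (e (σ p)).2) := by
    have h2 : ∀ᶠ s in 𝓝 p, (e s).2 = (e p).2 :=
      hcont ((isOpen_discrete {(e p).2}).mem_nhds rfl)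
    filter_upwards [hbase, h2] with s hs hs2
    have hmem : (q s, (e (σ p)).2) ∈ e.target := e.mem_target.2 hs
    have hq' : q (e.toOpenPartialHomeomorph.symm (q s, (e (σ p)).2)) = q s :=
      e.proj_symm_apply hmem
    refine (((hσ s).2.2 _ hq').resolve_left fun h ↦ hne ?_).symm
    have h3 := e.apply_symm_apply hmem
    rw [h] at h3
    rw [← hs2, h3]
  have hmem : (q p, (e (σ p)).2) ∈ e.target := e.mem_target.2 hp
  refine ContinuousAt.congr ?_ hlocal.symm
  exact (e.toOpenPartialHomeomorph.continuousAt_symm hmem).comp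
    (f := fun s ↦ (q s, (e (σ p)).2)) (hq.continuous.continuousAt.prodMk continuousAt_const)

variable [ChartedSpace (ℂ × ℂ) S] [ChartedSpace (ℂ × ℂ) S']

/-- By continuity, near `p` the map `σ` is `q` followed by the local inverse of `q` at `σ p`. -/
lemma isLocalDiffeomorphAt_swap
    (hσ : ∀ p, σ p ≠ p ∧ q (σ p) = q p ∧ ∀ p', q p' = q p → p' = p ∨ p' = σ p)
    (hq : IsCoveringMap q)
    (hqd : IsLocalDiffeomorph 𝓘(ℂ, ℂ × ℂ) 𝓘(ℂ, ℂ × ℂ) ω q) (p : S') :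
    IsLocalDiffeomorphAt 𝓘(ℂ, ℂ × ℂ) 𝓘(ℂ, ℂ × ℂ) ω σ p := by
  have h1 := (hqd (σ p)).localInverse_isLocalDiffeomorphAt
  rw [(hσ p).2.1] at h1
  refine isLocalDiffeomorphAt_congr ((hqd p).comp _ _ h1) ?_
  filter_upwards [(continuousAt_swap hσ hq p).eventually
    ((hqd (σ p)).localInverse.open_target.mem_nhds (hqd (σ p)).localInverse_mem_target)] with s hs
  rw [Function.comp_apply, ← (hσ s).2.1]
  exact (hqd (σ p)).localInverse_left_inv hs

/-- This makes `σ ∘ f` a second uniformization of `S'` with the same group, so that uniqueness can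
compare the two induced connections. -/
lemma IsQuotientBy.swap_comp {f : ℂ × ℂ → S'} {Γ : Subgroup (Equiv.Perm (ℂ × ℂ))}
    (h : IsQuotientBy Γ f)
    (hσ : ∀ p, σ p ≠ p ∧ q (σ p) = q p ∧ ∀ p', q p' = q p → p' = p ∨ p' = σ p)
    (hq : IsCoveringMap q)
    (hqd : IsLocalDiffeomorph 𝓘(ℂ, ℂ × ℂ) 𝓘(ℂ, ℂ × ℂ) ω q) : IsQuotientBy Γ (σ ∘ f) where
  isLocalDiffeomorphOn x :=
    (h.isLocalDiffeomorphOn x).comp _ _ (isLocalDiffeomorphAt_swap hσ hq hqd _)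
  surjOn p _ := by
    obtain ⟨x, hx, hxp⟩ := h.surjOn (Set.mem_univ (σ p))
    exact ⟨x, hx, by rw [Function.comp_apply, hxp, swap_swap hσ]⟩
  fibre x hx y hy := by
    rw [← h.fibre x hx y hy]
    exact (Function.LeftInverse.injective (swap_swap hσ)).eq_iff

end DoubleCovers

end Inoue

theorem mainTheorem4 {S : Type u} [TopologicalSpace S] [ChartedSpace (ℂ × ℂ) S]
    [IsManifold 𝓘(ℂ, ℂ × ℂ) ω S] (π : ℂ × ℂ → S) (hπ : Inoue.IsInoueUniformization π) :
    ∃ nabla : Inoue.AffineConnection S,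
      Inoue.IsHolomorphic nabla ∧ nabla.torsion = 0 ∧
      Inoue.PullsBackToStandard π Inoue.HC nabla ∧ Inoue.IsFlat nabla ∧
      ∀ nabla' : Inoue.AffineConnection S,
        Inoue.IsHolomorphic nabla' → nabla'.torsion = 0 → Inoue.SameConnection nabla' nabla := by
  open Inoue in
  obtain h | ⟨S', _, _, _, f, q, hf, hqd, hq, hq2, hπf⟩ := hπ
  · obtain ⟨Γ, hΓ, h⟩ := isInoueQuotient_iff.1 h
    obtain ⟨nabla, h1, h2, h3, h4⟩ := h.exists_connection hΓ
    exact ⟨nabla, h1, h2, h3, h4, fun nabla' h1' h2' ↦ sameConnection_of_isInoueGroup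
      h.isLocalDiffeomorphOn h.surjOn hΓ (fun g hg x hx ↦ h.apply_eq hΓ hg hx) h1' h1 h2' h2⟩
  · obtain ⟨Γ, hΓ, h⟩ := isInoueQuotient_iff.1 hf
    obtain ⟨σ, hσ⟩ := exists_swap hq2
    have hs := h.swap_comp hσ hq hqd
    obtain ⟨nabla, h1, h2, h3, -⟩ := h.exists_connection hΓ
    obtain ⟨nablas, h1s, h2s, h3s, -⟩ := hs.exists_connection hΓ
    -- Uniqueness on `S'` shows that `σ` preserves the connection.
    have hsame := sameConnection_of_isInoueGroup h.isLocalDiffeomorphOn h.surjOn hΓ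
      (fun g hg x hx ↦ h.apply_eq hΓ hg hx) h1s h1 h2s h2
    have h3' : PullsBackToStandard (σ ∘ f) HC nabla := fun Y x hx hY v ↦
      (h3s Y x hx hY v).trans (by rw [hsame Y _ hY])
    have hπs : ∀ x ∈ HC, π x = q ((σ ∘ f) x) := fun x hx ↦ (hπf x hx).trans (hσ (f x)).2.1.symm
    have hπd : IsLocalDiffeomorphOn 𝓘(ℂ, ℂ × ℂ) 𝓘(ℂ, ℂ × ℂ) ω π HC := fun x ↦
      isLocalDiffeomorphAt_congr ((h.isLocalDiffeomorphOn x).comp _ _ (hqd _))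
        (Filter.eventuallyEq_of_mem (isOpen_HC.mem_nhds x.2) fun y hy ↦ (hπf y hy).symm)
    have hπsurj : Set.SurjOn π HC Set.univ := fun p _ ↦ by
      obtain ⟨p', hp'⟩ := Set.nonempty_of_ncard_ne_zero (s := q ⁻¹' {p}) (by simp [hq2])
      obtain ⟨x, hx, rfl⟩ := h.surjOn (Set.mem_univ p')
      exact ⟨x, hx, (hπf x hx).trans hp'⟩
    obtain ⟨nabla₀, h1₀, h2₀, h3₀, h4₀⟩ := Inoue.exists_connection hπd hπsurj
      fun x hx y hy hxy Y hY ↦ by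
        rw [hπf x hx, hπf y hy] at hxy
        -- Points with equal image in `S` have images in `S'` that are equal or exchanged by `σ`.
        rcases (hσ (f y)).2.2 (f x) hxy with e | e
        · exact pushDeriv_comp_eq_of_pullsBack h.isLocalDiffeomorphOn h.isLocalDiffeomorphOn hqd
            hπf hπf h3 h3 hx hy e hY
        · exact pushDeriv_comp_eq_of_pullsBack h.isLocalDiffeomorphOn hs.isLocalDiffeomorphOn hqd
            hπf hπs h3 h3' hx hy e hY
    refine ⟨nabla₀, h1₀, h2₀, h3₀, h4₀, fun nabla' h1' h2' ↦ sameConnection_of_isInoueGroup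
      hπd hπsurj hΓ (fun g hg x hx ↦ ?_) h1' h1₀ h2' h2₀⟩
    obtain ⟨-, -, -, hgH⟩ := hΓ.isAffineOfHC hg
    rw [hπf x hx, hπf _ ((hgH x).2 hx), h.apply_eq hΓ hg hx]
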